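/- Fix a number $n$ of bosonic modes with annihilation operators $a_1,\dots,a_n$ on Fock space, quadratures $x_i=(a_i+a_i^\dagger)/\sqrt2$, $p_i=(a_i-a_i^\dagger)/(\sqrt2\,i)$, and $q=(x_1,p_1,\dots,x_n,p_n)$. Let $D_{\mathrm{tr}}(\rho,\sigma)=\frac12\operatorname{tr}|\rho-\sigma|$, and let $\Omega$ be the standard symplectic form on $\mathbb R^{2n}$, the direct sum of $n$ blocks $\begin{pmatrix}0&1\\-1&0\end{pmatrix}$. For $\alpha\in\mathbb C^n$ let $|\alpha\rangle=|\alpha_1\rangle\cdots|\alpha_n\rangle$ be the product coherent state. A state is classical if it is of the form $\int|\alpha\rangle\langle\alpha|\,dP(\alpha)$ for a probability measure $P$ on $\mathbb C^n$. For a pure state $\psi$ with finite second moments let $V(\psi)$ be its $2n\times 2n$ covariance matrix, $V_{st}=\langle\tfrac12\{q_s,q_t\}\rangle-\langle q_s\rangle\langle q_t\rangle$. Put $$\mathcal V_k(\psi)=\max_{\dim T=k}\operatorname{tr}_T\!\big[V(\psi)-\tfrac12 I\big]\quad(1\le k\le 2n),\qquad \mathcal W_k(\psi)=\max_{|S|=k}\operatorname{tr}_S\!\big[V(\psi)-\tfrac12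 I\big]\quad(1\le k\le n),$$ where $T$ runs over the $k$-dimensional subspaces of $\mathbb R^{2n}$ and $S$ over the symplectic subspaces of $k$ modes, i.e. the images of the span of the canonical planes of the first $k$ modes under matrices $R$ with $R^TR=RR^T=I$, $R^T\Omega R=\Omega$. If $\psi$ has an infinite second moment, put $\mathcal V_k(\psi)=\mathcal W_k(\psi)=+\infty$. For a density operator $\rho$ let $$\hat{\mathcal V}_k(\rho)=\inf_\mu\int\mathcal V_k(\psi)\,d\mu(\psi),\qquad \hat{\mathcal W}_k(\rho)=\inf_\mu\int\mathcal W_k(\psi)\,d\mu(\psi),$$ the infimum being over all probability measures $\mu$ on the set of pure states with $\rho=\int|\psi\rangle\langle\psi|\,d\mu(\psi)$. Then: 1. For every $n$-mode pure state $\psi$ there is a coherent state $\phi=|\alpha\rangle$ with $D_{\mathrm{tr}}(\psi,\phi)^2\le n\,\mathcal V_1(\psi)$. 2. For every $1\le k\le 2n$, $\mathcal V_k\ge 0$ on pure states, and for every density operator $\rho$, $\hat{\mathcal V}_k(\rho)=0$ if and only if $\rho$ is classical. 3. For every $1\le k\le n$, $\mathcal W_k\ge 0$ on pure states, and for every density operator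 $\rho$, $\hat{\mathcal W}_k(\rho)=0$ if and only if $\rho$ is classical. -/

import Mathlib

open MeasureTheory
open scoped ENNReal InnerProductSpace Kronecker

noncomputable section

namespace BosonicModes

/-! ### Fock space, ladder operators and quadratures -/

/-- The Hilbert space of `n` bosonic modes in the Fock (number) representation: square-summable
complex amplitudes indexed by the occupation numbers `m = (m₁, …, mₙ)`. -/
abbrev Fock (n : ℕ) : Type := lp (fun _ : Fin n → ℕ => ℂ) 2

/-- The Borel σ-algebra of the norm topology. -/
instance instMeasurableSpaceFock (n : ℕ) : MeasurableSpace (Fock n) := borel _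

instance instBorelSpaceFock (n : ℕ) : BorelSpace (Fock n) := ⟨rfl⟩

/-- Pure states, represented by unit vectors. -/
abbrev PureState (n : ℕ) : Type := Metric.sphere (0 : Fock n) 1

/-- Bounded operators on the Hilbert space of `n` modes. -/
abbrev Op (n : ℕ) : Type := Fock n →L[ℂ] Fock n

/-- The number state `|m⟩`. -/
def numberState {n : ℕ} (m : Fin n → ℕ) : Fock n :=
  lp.single (E := fun _ : Fin n → ℕ => ℂ) 2 m (1 : ℂ)

/-- Amplitudes of `a_i ψ`: `⟨m| a_i ψ⟩ = √(m_i + 1) ⟨m + e_i | ψ⟩`. -/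
def annihilate {n : ℕ} (i : Fin n) (ψ : (Fin n → ℕ) → ℂ) : (Fin n → ℕ) → ℂ :=
  fun m => (Real.sqrt (m i + 1) : ℂ) * ψ (Function.update m i (m i + 1))

/-- Amplitudes of `a_i† ψ`: `⟨m| a_i† ψ⟩ = √m_i ⟨m - e_i | ψ⟩` (which is `0` if `m_i = 0`). -/
def create {n : ℕ} (i : Fin n) (ψ : (Fin n → ℕ) → ℂ) : (Fin n → ℕ) → ℂ :=
  fun m => (Real.sqrt (m i) : ℂ) * ψ (Function.update m i (m i - 1))

/-- Amplitudes of `q_s ψ`. The index `(i, 0)` stands for `x_i = (a_i + a_i†) / √2` and `(i, 1)`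
for `p_i = (a_i - a_i†) / (√2 i)`. -/
def quadratureAmp {n : ℕ} (s : Fin n × Fin 2) (ψ : (Fin n → ℕ) → ℂ) : (Fin n → ℕ) → ℂ :=
  fun m =>
    if s.2 = 0 then
      (annihilate s.1 ψ m + create s.1 ψ m) / (Real.sqrt 2 : ℂ)
    else
      (annihilate s.1 ψ m - create s.1 ψ m) / ((Real.sqrt 2 : ℂ) * Complex.I)

/-- `ψ` lies in the (maximal) domain of every quadrature operator, i.e. all second moments of the
quadratures are finite. -/
def HasFiniteSecondMoments {n : ℕ} (ψ : Fock n) : Prop :=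
  ∀ s : Fin n × Fin 2, Memℓp (E := fun _ : Fin n → ℕ => ℂ) (quadratureAmp s ψ) 2

open Classical in
/-- The vector `q_s ψ`, for `ψ` in the domain of `q_s` (and `0` otherwise). -/
def quadrature {n : ℕ} (s : Fin n × Fin 2) (ψ : Fock n) : Fock n :=
  if h : Memℓp (E := fun _ : Fin n → ℕ => ℂ) (quadratureAmp s ψ) 2 then
    ⟨quadratureAmp s ψ, h⟩
  else 0

/-- The covariance matrix `V_st = ⟨(q_s q_t + q_t q_s)/2⟩ - ⟨q_s⟩⟨q_t⟩` of a pure state with finite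
second moments, where `⟨(q_s q_t + q_t q_s)/2⟩ = Re ⟨q_s ψ | q_t ψ⟩`. -/
def covariance {n : ℕ} (ψ : Fock n) : Matrix (Fin n × Fin 2) (Fin n × Fin 2) ℝ :=
  Matrix.of fun s t =>
    (⟪quadrature s ψ, quadrature t ψ⟫_ℂ).re
      - (⟪ψ, quadrature s ψ⟫_ℂ).re * (⟪ψ, quadrature t ψ⟫_ℂ).re

/-! ### Phase-space variances of pure states -/

/-- The phase space `ℝ²ⁿ` with its Euclidean structure. -/
abbrev PhaseSpace (n : ℕ) : Type := EuclideanSpace ℝ (Fin n × Fin 2)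

/-- `tr_T M`, the trace of the compression of the matrix `M` to the subspace `T`. -/
def traceOn {n : ℕ} (T : Submodule ℝ (PhaseSpace n))
    (M : Matrix (Fin n × Fin 2) (Fin n × Fin 2) ℝ) : ℝ :=
  LinearMap.trace ℝ T
    ((T.orthogonalProjectionOnto : PhaseSpace n →ₗ[ℝ] T) ∘ₗ Matrix.toEuclideanLin M ∘ₗ T.subtype)

open Classical in
/-- `𝒱_k(ψ) = max_{dim T = k} tr_T [V(ψ) - I/2]`; it is `+∞` if some quadrature has infinite
variance. -/
def varV {n : ℕ} (k : ℕ) (ψ : Fock n) : EReal :=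
  if HasFiniteSecondMoments ψ then
    ⨆ (T : Submodule ℝ (PhaseSpace n)) (_ : Module.finrank ℝ T = k),
      ((traceOn T (covariance ψ - (1 / 2 : ℝ) • 1) : ℝ) : EReal)
  else ⊤

/-- The symplectic form `Ω`, the direct sum of `n` blocks `(0 1; -1 0)`. -/
def symplecticForm (n : ℕ) : Matrix (Fin n × Fin 2) (Fin n × Fin 2) ℝ :=
  (1 : Matrix (Fin n) (Fin n) ℝ) ⊗ₖ !![0, 1; -1, 0]

/-- The span of the canonical planes of the first `k` modes. -/
def canonicalSubspace (n k : ℕ) : Submodule ℝ (PhaseSpace n) :=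
  Submodule.span ℝ {v | ∃ s : Fin n × Fin 2, (s.1 : ℕ) < k ∧ v = EuclideanSpace.single s (1 : ℝ)}

/-- Symplectic subspaces corresponding to a choice of `k` modes: the images of the canonical one
under an orthogonal symplectic matrix. -/
def IsModeSubspace {n : ℕ} (k : ℕ) (S : Submodule ℝ (PhaseSpace n)) : Prop :=
  ∃ R : Matrix (Fin n × Fin 2) (Fin n × Fin 2) ℝ,
    R.transpose * R = 1 ∧ R * R.transpose = 1 ∧
    R.transpose * symplecticForm n * R = symplecticForm n ∧
    S = (canonicalSubspace n k).map (Matrix.toEuclideanLin R)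

open Classical in
/-- `𝒲_k(ψ) = max_{|S| = k} tr_S [V(ψ) - I/2]` over symplectic subspaces `S` of `k` modes; it is
`+∞` if some quadrature has infinite variance. -/
def varW {n : ℕ} (k : ℕ) (ψ : Fock n) : EReal :=
  if HasFiniteSecondMoments ψ then
    ⨆ (S : Submodule ℝ (PhaseSpace n)) (_ : IsModeSubspace k S),
      ((traceOn S (covariance ψ - (1 / 2 : ℝ) • 1) : ℝ) : EReal)
  else ⊤

/-! ### Coherent states -/

/-- Amplitudes of the product `|α₁⟩ ⋯ |αₙ⟩` of coherent states. -/
def coherentAmp {n : ℕ} (α : Fin n → ℂ) : (Fin n → ℕ) → ℂ :=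
  fun m => ∏ i, ((Real.exp (-‖α i‖ ^ 2 / 2) : ℂ) * α i ^ m i / (Real.sqrt (m i).factorial : ℂ))

theorem summable_pi_prod {n : ℕ} (f : Fin n → ℕ → ℝ) (hf : ∀ i j, 0 ≤ f i j)
    (hs : ∀ i, Summable (f i)) : Summable fun m : Fin n → ℕ => ∏ i, f i (m i) := by
  induction n with
  | zero => exact Summable.of_finite
  | succ n ih =>
    have h := ih (fun i => f i.succ) (fun i => hf i.succ) (fun i => hs i.succ)
    have h2 := (hs 0).mul_of_nonneg h (hf 0)
      (fun m => Finset.prod_nonneg fun i _ => hf i.succ (m i))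
    refine ((Fin.consEquiv fun _ : Fin (n + 1) => ℕ).summable_iff).mp ?_
    refine h2.congr fun x => ?_
    simp [Fin.consEquiv, Fin.prod_univ_succ]

theorem memℓp_coherentAmp {n : ℕ} (α : Fin n → ℂ) :
    Memℓp (E := fun _ : Fin n → ℕ => ℂ) (coherentAmp α) 2 := by
  refine memℓp_gen ?_
  have h := summable_pi_prod (n := n)
    (fun i j => Real.exp (-‖α i‖ ^ 2) * ((‖α i‖ ^ 2) ^ j / j.factorial))
    (fun i j => by positivity)
    (fun i => (Real.summable_pow_div_factorial (‖α i‖ ^ 2)).mul_left _)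
  refine h.congr fun m => ?_
  have h2 : (2 : ℝ≥0∞).toReal = ((2 : ℕ) : ℝ) := by simp
  rw [h2, Real.rpow_natCast, coherentAmp, norm_prod, ← Finset.prod_pow]
  refine Finset.prod_congr rfl fun i _ => ?_
  rw [norm_div, norm_mul, norm_pow, Complex.norm_real, Complex.norm_real, div_pow, mul_pow,
    Real.norm_of_nonneg (Real.exp_pos _).le, Real.norm_of_nonneg (Real.sqrt_nonneg _),
    Real.sq_sqrt (Nat.cast_nonneg _), ← Real.exp_nat_mul]
  have h3 : ((2 : ℕ) : ℝ) * (-‖α i‖ ^ 2 / 2) = -‖α i‖ ^ 2 := by push_cast; ring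
  rw [h3]
  ring

/-- The `n`-mode coherent state `|α⟩ = |α₁⟩ ⋯ |αₙ⟩`. -/
def coherent {n : ℕ} (α : Fin n → ℂ) : Fock n := ⟨coherentAmp α, memℓp_coherentAmp α⟩

/-! ### Mixed states, trace distance, classical states and convex roofs -/

/-- The operator `|ψ⟩⟨ψ|`. -/
def proj {n : ℕ} (ψ : Fock n) : Op n := InnerProductSpace.rankOne ℂ ψ ψ

/-- The operator absolute value `|A| = (A† A)^(1/2)`. -/
def opAbs {H : Type*} [NormedAddCommGroup H] [InnerProductSpace ℂ H] [CompleteSpace H]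
    (A : H →L[ℂ] H) : H →L[ℂ] H := CFC.abs A

/-- `tr |A|`, computed in the number basis. -/
def traceAbs {n : ℕ} (A : Op n) : ℝ≥0∞ :=
  ∑' m : Fin n → ℕ, ENNReal.ofReal (⟪numberState m, opAbs A (numberState m)⟫_ℂ).re

/-- The trace distance `(1/2) tr |ρ - σ|`. -/
def traceDist {n : ℕ} (ρ σ : Op n) : ℝ≥0∞ := traceAbs (ρ - σ) / 2

/-- Density operators: positive operators of trace one. -/
def IsDensityOperator {n : ℕ} (ρ : Op n) : Prop :=
  ρ.IsPositive ∧ HasSum (fun m : Fin n → ℕ => ⟪numberState m, ρ (numberState m)⟫_ℂ) 1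

/-- Classical states: `ρ = ∫ |α⟩⟨α| dP(α)`, as a weak integral, for some probability measure `P`
on `ℂⁿ`. -/
def IsClassical {n : ℕ} (ρ : Op n) : Prop :=
  ∃ P : Measure (Fin n → ℂ), IsProbabilityMeasure P ∧
    ∀ x y : Fock n, ⟪x, ρ y⟫_ℂ = ∫ α, ⟪x, coherent α⟫_ℂ * ⟪coherent α, y⟫_ℂ ∂P

/-- A (possibly continuous) decomposition `ρ = ∫ |ψ⟩⟨ψ| dμ(ψ)` of `ρ` into pure states, as a weak
integral over a probability measure `μ` on the set of pure states. -/
def IsDecomposition {n : ℕ} (ρ : Op n) (μ : Measure (PureState n)) : Prop :=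
  IsProbabilityMeasure μ ∧
    ∀ x y : Fock n, ⟪x, ρ y⟫_ℂ = ∫ ψ : PureState n, ⟪x, (ψ : Fock n)⟫_ℂ * ⟪(ψ : Fock n), y⟫_ℂ ∂μ

/-- The convex roof: the infimum of the average of `f` over all decompositions of `ρ` into pure
states, for a function `f` that is nonnegative on pure states. -/
def convexRoof {n : ℕ} (f : Fock n → EReal) (ρ : Op n) : ℝ≥0∞ :=
  ⨅ (μ : Measure (PureState n)) (_ : IsDecomposition ρ μ),
    ∫⁻ ψ : PureState n, (f (ψ : Fock n)).toENNReal ∂μ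

end BosonicModes

end

/-! The engine is a spectral gap. The displaced number operator `∑ (a_i - α_i)†(a_i - α_i)` has
ground state `|α⟩` with eigenvalue 0 and next eigenvalue 1, so `1 - |⟨α|ψ⟩|² ≤ ∑ ‖(a_i - α_i)ψ‖²`
for unit `ψ` (`sqNorm_le_sum_annihilate`). At `α_i = ⟨a_i⟩` the right side is half the trace of
`V(ψ) - I/2` (`LadderVectors.excess_mode`, `exists_coherent_overlap`), and each mode contributes a
nonnegative amount. Choosing coordinates, or modes, whose share of this trace is at least average
bounds it by `n` times the trace on a suitable `k`-dimensional or `k`-mode subspace. Hence both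
variances are nonnegative and control the infidelity to some coherent state (`DominatesOverlap`).
For pure states the squared trace distance is exactly `1 - |⟨φ|ψ⟩|²` (`traceDist_proj_sq`), which
gives the first claim.

For the convex roofs, coherent states have covariance exactly `I/2` (`excess_coherent`), so a
mixture of them is a decomposition of zero cost. Conversely, if the roof vanishes, there are
decompositions of arbitrarily small mean cost. Replacing each pure state, in a measurable way, by a
nearly closest coherent state gives mixtures of coherent states converging weakly to `ρ`
(`exists_isApproxClassical`). Coherent states of large amplitude leave every finite set of number
states, whereas `ρ` has trace one, so no mass escapes and the mixing measures are tight. Prokhorov's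
theorem then provides a limiting measure that represents `ρ`
(`isClassical_of_forall_isApproxClassical`). -/

noncomputable section

namespace BosonicModes

/-! ### Square sums of amplitudes -/

/-- The square sum `∑ |f m|²` with values in `[0, ∞]`. -/
def sqNorm {ι : Type*} (f : ι → ℂ) : ℝ≥0∞ := ∑' m, ‖f m‖ₑ ^ 2

theorem enorm_sq_eq_ofReal (z : ℂ) : ‖z‖ₑ ^ 2 = ENNReal.ofReal (‖z‖ ^ 2) := by
  rw [← ofReal_norm, ENNReal.ofReal_pow (norm_nonneg _)]

theorem summable_of_sqNorm_ne_top {ι : Type*} {f : ι → ℂ} (h : sqNorm f ≠ ⊤) :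
    Summable fun m => ‖f m‖ ^ 2 := by
  unfold sqNorm at h
  simp_rw [enorm_sq_eq_ofReal] at h
  have := ENNReal.summable_toReal h
  exact this.congr fun m => ENNReal.toReal_ofReal (by positivity)

theorem memℓp_two_iff {ι : Type*} (f : ι → ℂ) :
    Memℓp (E := fun _ : ι => ℂ) f 2 ↔ sqNorm f ≠ ⊤ := by
  have h2 : (2 : ℝ≥0∞).toReal = ((2 : ℕ) : ℝ) := by simp
  rw [memℓp_gen_iff (by simp)]
  simp_rw [h2, Real.rpow_natCast]
  constructor
  · intro h
    unfold sqNorm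
    simp_rw [enorm_sq_eq_ofReal]
    exact h.tsum_ofReal_ne_top
  · exact summable_of_sqNorm_ne_top

theorem sqNorm_coe {ι : Type*} (x : lp (fun _ : ι => ℂ) 2) :
    sqNorm (x : ι → ℂ) = ENNReal.ofReal (‖x‖ ^ 2) := by
  have h := (memℓp_two_iff _).1 (lp.memℓp x)
  have hs := summable_of_sqNorm_ne_top h
  have h2 := lp.norm_rpow_eq_tsum (p := 2) (by simp) x
  have h3 : (2 : ℝ≥0∞).toReal = ((2 : ℕ) : ℝ) := by simp
  simp_rw [h3, Real.rpow_natCast] at h2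
  rw [h2, ENNReal.ofReal_tsum_of_nonneg (fun _ => by positivity) hs]
  exact tsum_congr fun m => enorm_sq_eq_ofReal _

/-- Cauchy–Schwarz. Values in `[0, ∞]` let it apply to amplitudes that are not square summable, as
happens outside the domain of a ladder operator. -/
theorem enorm_tsum_conj_mul_sq_le {ι : Type*} {c f : ι → ℂ} (hc : sqNorm c ≤ 1) :
    ‖∑' k, starRingEnd ℂ (c k) * f k‖ₑ ^ 2 ≤ sqNorm f := by
  by_cases hf : sqNorm f = ⊤
  · simp [hf]
  have hc' : sqNorm c ≠ ⊤ := ne_top_of_le_ne_top ENNReal.one_ne_top hc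
  let C : lp (fun _ : ι => ℂ) 2 := ⟨c, (memℓp_two_iff c).2 hc'⟩
  let F : lp (fun _ : ι => ℂ) 2 := ⟨f, (memℓp_two_iff f).2 hf⟩
  have h1 : ‖C‖ ^ 2 ≤ 1 := by
    have := sqNorm_coe C
    change sqNorm c = _ at this
    rw [this] at hc
    exact ENNReal.ofReal_le_one.1 hc
  have h2 : (∑' k, starRingEnd ℂ (c k) * f k) = ⟪C, F⟫_ℂ := by
    rw [lp.inner_eq_tsum]
    exact tsum_congr fun k => by simp [C, F, mul_comm]
  have h3 : sqNorm f = ENNReal.ofReal (‖F‖ ^ 2) := sqNorm_coe F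
  rw [h2, h3, enorm_sq_eq_ofReal]
  refine ENNReal.ofReal_le_ofReal ?_
  have h4 : ‖C‖ ≤ 1 := by nlinarith [norm_nonneg C]
  have h5 := norm_inner_le_norm (𝕜 := ℂ) C F
  have h6 : ‖⟪C, F⟫_ℂ‖ ≤ ‖F‖ := h5.trans (by nlinarith [norm_nonneg F])
  gcongr

/-! ### The spectral gap of one mode -/

/-- Amplitudes of the one-mode coherent state. -/
def coherentAmpOne (α : ℂ) : ℕ → ℂ :=
  fun k => (Real.exp (-‖α‖ ^ 2 / 2) : ℂ) * α ^ k / (Real.sqrt k.factorial : ℂ)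

theorem hasSum_norm_coherentAmpOne_sq (α : ℂ) :
    HasSum (fun k => ‖coherentAmpOne α k‖ ^ 2) 1 := by
  have h := (NormedSpace.expSeries_div_hasSum_exp (𝔸 := ℝ) (‖α‖ ^ 2)).mul_left
    (Real.exp (-‖α‖ ^ 2))
  rw [← Real.exp_eq_exp_ℝ, ← Real.exp_add, neg_add_cancel, Real.exp_zero] at h
  refine (congrArg (fun f : ℕ → ℝ => HasSum f 1) (funext fun k => ?_)).mpr h
  rw [coherentAmpOne, norm_div, norm_mul, norm_pow, Complex.norm_real, Complex.norm_real, div_pow,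
    mul_pow, Real.norm_of_nonneg (Real.exp_pos _).le, Real.norm_of_nonneg (Real.sqrt_nonneg _),
    Real.sq_sqrt (Nat.cast_nonneg _), ← Real.exp_nat_mul]
  have h3 : ((2 : ℕ) : ℝ) * (-‖α‖ ^ 2 / 2) = -‖α‖ ^ 2 := by push_cast; ring
  rw [h3]
  ring

theorem sqNorm_coherentAmpOne (α : ℂ) : sqNorm (coherentAmpOne α) = 1 := by
  unfold sqNorm
  simp_rw [enorm_sq_eq_ofReal]
  rw [← ENNReal.ofReal_tsum_of_nonneg (fun _ => by positivity)
    (hasSum_norm_coherentAmpOne_sq α).summable, (hasSum_norm_coherentAmpOne_sq α).tsum_eq]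
  simp

theorem sqrt_succ_mul_coherentAmpOne (α : ℂ) (k : ℕ) :
    (Real.sqrt (k + 1) : ℂ) * coherentAmpOne α (k + 1) = α * coherentAmpOne α k := by
  have h1 : (Real.sqrt (k + 1) : ℂ) ≠ 0 := by
    exact_mod_cast (Real.sqrt_pos.2 (by positivity)).ne'
  have h2 : (Real.sqrt k.factorial : ℂ) ≠ 0 := by
    exact_mod_cast (Real.sqrt_pos.2 (by exact_mod_cast k.factorial_pos)).ne'
  have h3 : (Real.sqrt (k + 1).factorial : ℂ)
      = (Real.sqrt (k + 1) : ℂ) * (Real.sqrt k.factorial : ℂ) := by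
    rw [Nat.factorial_succ, Nat.cast_mul, Real.sqrt_mul (Nat.cast_nonneg _)]
    push_cast
    rfl
  rw [coherentAmpOne, coherentAmpOne, h3, pow_succ]
  field_simp
  ring

/-- The eigenvalue equation `aφ = αφ` is a first-order recurrence, so the eigenspace is
one-dimensional; the exponential undoes the normalization of the coherent state at `k = 0`. -/
theorem eq_smul_coherentAmpOne {α : ℂ} {φ : ℕ → ℂ}
    (h : ∀ k : ℕ, (Real.sqrt (k + 1) : ℂ) * φ (k + 1) = α * φ k) (k : ℕ) :
    φ k = φ 0 * (Real.exp (‖α‖ ^ 2 / 2) : ℂ) * coherentAmpOne α k := by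
  induction k with
  | zero =>
    simp only [coherentAmpOne, pow_zero, Nat.factorial_zero, Nat.cast_one, Real.sqrt_one, mul_one,
      Complex.ofReal_one, div_one]
    rw [mul_assoc, ← Complex.ofReal_mul, ← Real.exp_add]
    have : ‖α‖ ^ 2 / 2 + -‖α‖ ^ 2 / 2 = 0 := by ring
    simp [this]
  | succ k ih =>
    have h1 : (Real.sqrt (k + 1) : ℂ) ≠ 0 := by
      exact_mod_cast (Real.sqrt_pos.2 (by positivity)).ne'
    apply mul_left_cancel₀ h1
    rw [h k, ih]
    linear_combination (-(φ 0 * (Real.exp (‖α‖ ^ 2 / 2) : ℂ))) * sqrt_succ_mul_coherentAmpOne α k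

/-- The vectors `(a† - ᾱ) |k⟩`. -/
def shiftedCreate (α : ℂ) (k : ℕ) : lp (fun _ : ℕ => ℂ) 2 :=
  (Real.sqrt (k + 1) : ℂ) • lp.single (E := fun _ : ℕ => ℂ) 2 (k + 1) (1 : ℂ)
    - (starRingEnd ℂ α) • lp.single (E := fun _ : ℕ => ℂ) 2 k (1 : ℂ)

/-- The vectors `(a - α) |k⟩`. -/
def shiftedAnnihilate (α : ℂ) (k : ℕ) : lp (fun _ : ℕ => ℂ) 2 :=
  (Real.sqrt k : ℂ) • lp.single (E := fun _ : ℕ => ℂ) 2 (k - 1) (1 : ℂ)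
    - α • lp.single (E := fun _ : ℕ => ℂ) 2 k (1 : ℂ)

theorem inner_shiftedCreate (α : ℂ) (k : ℕ) (φ : lp (fun _ : ℕ => ℂ) 2) :
    ⟪shiftedCreate α k, φ⟫_ℂ = (Real.sqrt (k + 1) : ℂ) * φ (k + 1) - α * φ k := by
  rw [shiftedCreate, inner_sub_left, inner_smul_left, inner_smul_left, lp.inner_single_left,
    lp.inner_single_left]
  simp

/-- The commutation relation `[a - α, a† - ᾱ] = 1`, read as an identity of Gram matrices so that no
unbounded operator is needed. -/
theorem inner_shiftedCreate_shiftedCreate (α : ℂ) (j k : ℕ) :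
    ⟪shiftedCreate α j, shiftedCreate α k⟫_ℂ =
      ⟪shiftedAnnihilate α j, shiftedAnnihilate α k⟫_ℂ
        + ⟪lp.single (E := fun _ : ℕ => ℂ) 2 j (1 : ℂ),
          lp.single (E := fun _ : ℕ => ℂ) 2 k (1 : ℂ)⟫_ℂ := by
  have key : ∀ (a b : ℕ), (lp.single (E := fun _ : ℕ => ℂ) 2 a (1 : ℂ) : ℕ → ℂ) b
      = if b = a then 1 else 0 := by
    intro a b
    rw [lp.coeFn_single, Pi.single_apply]
  simp only [shiftedCreate, shiftedAnnihilate, inner_sub_left, inner_sub_right, inner_smul_left,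
    inner_smul_right, lp.inner_single_left, key]
  have hs : ∀ x : ℕ, ((Real.sqrt x : ℝ) : ℂ) * (Real.sqrt x : ℂ) = x := by
    intro x
    rw [← Complex.ofReal_mul, Real.mul_self_sqrt (Nat.cast_nonneg _)]
    simp
  have hs1 : ∀ x : ℕ, ((Real.sqrt (x + 1) : ℝ) : ℂ) * (Real.sqrt (x + 1) : ℂ) = x + 1 := by
    intro x
    rw [← Complex.ofReal_mul, Real.mul_self_sqrt (by positivity)]
    simp
  -- All three Gram matrices are tridiagonal, so only `|j - k| ≤ 1` matters. At index 0 the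
  -- truncated `k - 1` is harmless because its coefficient is `√0`.
  rcases lt_trichotomy j k with h | h | h
  · obtain ⟨d, rfl⟩ := Nat.exists_eq_add_of_lt h
    rcases d with _ | d
    · rcases j with _ | j <;> (simp; try grind)
    · rcases j with _ | j <;> (simp; try grind)
  · subst h
    rcases j with _ | j
    · simp; ring
    · have := hs1 j
      have := hs1 (j + 1)
      simp at *
      grind
  · obtain ⟨d, rfl⟩ := Nat.exists_eq_add_of_lt h
    rcases d with _ | d
    · rcases k with _ | j <;> (simp; try grind)
    · rcases k with _ | j <;> (simp; try grind)


/-- By the commutation relation `‖(a† - ᾱ)χ‖² = ‖(a - α)χ‖² + ‖χ‖²` on finitely supported `χ`. -/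
theorem linearCombination_shiftedCreate_norm_ge (α : ℂ) (χ : ℕ →₀ ℂ) :
    ‖Finsupp.linearCombination ℂ
        (fun k => lp.single (E := fun _ : ℕ => ℂ) 2 k (1 : ℂ)) χ‖
      ≤ ‖Finsupp.linearCombination ℂ (shiftedCreate α) χ‖ := by
  have expand : ∀ v : ℕ → lp (fun _ : ℕ => ℂ) 2,
      ⟪Finsupp.linearCombination ℂ v χ, Finsupp.linearCombination ℂ v χ⟫_ℂ
        = ∑ j ∈ χ.support, ∑ k ∈ χ.support, starRingEnd ℂ (χ j) * (χ k * ⟪v j, v k⟫_ℂ) := by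
    intro v
    rw [Finsupp.linearCombination_apply, Finsupp.sum, sum_inner]
    refine Finset.sum_congr rfl fun j _ => ?_
    rw [inner_sum]
    refine Finset.sum_congr rfl fun k _ => ?_
    rw [inner_smul_left, inner_smul_right]
  have h : ⟪Finsupp.linearCombination ℂ (shiftedCreate α) χ,
        Finsupp.linearCombination ℂ (shiftedCreate α) χ⟫_ℂ
      = ⟪Finsupp.linearCombination ℂ (shiftedAnnihilate α) χ,
          Finsupp.linearCombination ℂ (shiftedAnnihilate α) χ⟫_ℂ
        + ⟪Finsupp.linearCombination ℂ
              (fun k => lp.single (E := fun _ : ℕ => ℂ) 2 k (1 : ℂ)) χ,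
            Finsupp.linearCombination ℂ
              (fun k => lp.single (E := fun _ : ℕ => ℂ) 2 k (1 : ℂ)) χ⟫_ℂ := by
    simp_rw [expand, inner_shiftedCreate_shiftedCreate, mul_add, Finset.sum_add_distrib]
  simp only [inner_self_eq_norm_sq_to_K] at h
  have h' : ‖Finsupp.linearCombination ℂ (shiftedCreate α) χ‖ ^ 2
      = ‖Finsupp.linearCombination ℂ (shiftedAnnihilate α) χ‖ ^ 2
        + ‖Finsupp.linearCombination ℂ
            (fun k => lp.single (E := fun _ : ℕ => ℂ) 2 k (1 : ℂ)) χ‖ ^ 2 := by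
    exact_mod_cast h
  refine le_of_sq_le_sq ?_ (norm_nonneg _)
  rw [h']
  exact le_add_of_nonneg_left (by positivity)

/-- The spectral gap by duality. Let `w` be the part of `u` orthogonal to the coherent state `c`.
For finite `χ`, `|⟨(a† - ᾱ)χ, w⟩| = |⟨χ, v⟩| ≤ ‖(a† - ᾱ)χ‖ ‖v‖`. The vectors `(a† - ᾱ)χ` are dense
in the complement of `c`, so the bound may be tested on `w` itself, giving `‖w‖ ≤ ‖v‖`. -/
theorem norm_sq_le_oneMode (α : ℂ) (c u v : lp (fun _ : ℕ => ℂ) 2)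
    (hc : ∀ k, c k = coherentAmpOne α k)
    (hv : ∀ k : ℕ, v k = (Real.sqrt (k + 1) : ℂ) * u (k + 1) - α * u k) :
    ‖u‖ ^ 2 ≤ ‖v‖ ^ 2 + ‖⟪c, u⟫_ℂ‖ ^ 2 := by
  have hcn : ‖c‖ ^ 2 = 1 := by
    have h1 := sqNorm_coe c
    have h2 : (c : ℕ → ℂ) = coherentAmpOne α := funext hc
    rw [h2, sqNorm_coherentAmpOne] at h1
    have := congrArg ENNReal.toReal h1
    rw [ENNReal.toReal_ofReal (by positivity)] at this
    simpa using this.symm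
  have hcc : ⟪c, c⟫_ℂ = 1 := by
    rw [inner_self_eq_norm_sq_to_K, ← RCLike.ofReal_pow, hcn, RCLike.ofReal_one]
  set w := u - ⟪c, u⟫_ℂ • c with hw
  have hcw : ⟪c, w⟫_ℂ = 0 := by
    rw [hw, inner_sub_right, inner_smul_right, hcc, mul_one, sub_self]
  have hnorm : ‖u‖ ^ 2 = ‖w‖ ^ 2 + ‖⟪c, u⟫_ℂ‖ ^ 2 := by
    have h1 : u = w + ⟪c, u⟫_ℂ • c := by rw [hw]; abel
    have h2 : ⟪w, ⟪c, u⟫_ℂ • c⟫_ℂ = 0 := by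
      rw [inner_smul_right, ← inner_conj_symm w c, hcw]
      simp
    have h3 := norm_add_sq_eq_norm_sq_add_norm_sq_of_inner_eq_zero w (⟪c, u⟫_ℂ • c) h2
    rw [← h1, norm_smul] at h3
    nlinarith
  have hwv : ∀ k, ⟪shiftedCreate α k, w⟫_ℂ = v k := by
    intro k
    rw [inner_shiftedCreate, hv]
    have h1 := sqrt_succ_mul_coherentAmpOne α k
    simp only [hw, lp.coeFn_sub, lp.coeFn_smul, Pi.sub_apply, Pi.smul_apply, smul_eq_mul, hc]
    linear_combination (-⟪c, u⟫_ℂ) * h1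
  let B := LinearMap.range (Finsupp.linearCombination ℂ (shiftedCreate α))
  -- A vector orthogonal to every `(a† - ᾱ)|k⟩` solves `aφ = αφ`, so it is a multiple of `c`, and
  -- `w` is orthogonal to it.
  have hmem : w ∈ B.topologicalClosure := by
    rw [← Submodule.orthogonal_orthogonal_eq_closure, Submodule.mem_orthogonal]
    intro φ hφ
    rw [Submodule.mem_orthogonal] at hφ
    have h1 : ∀ k : ℕ, (Real.sqrt (k + 1) : ℂ) * φ (k + 1) = α * φ k := by
      intro k
      have := hφ (shiftedCreate α k) ⟨Finsupp.single k 1, by simp⟩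
      rw [inner_shiftedCreate] at this
      exact sub_eq_zero.1 this
    have h2 : φ = (φ 0 * (Real.exp (‖α‖ ^ 2 / 2) : ℂ)) • c := by
      ext k
      rw [eq_smul_coherentAmpOne h1 k, lp.coeFn_smul, Pi.smul_apply, hc, smul_eq_mul]
    rw [h2, inner_smul_left, hcw, mul_zero]
  have hbound : ∀ z ∈ B.topologicalClosure, ‖⟪z, w⟫_ℂ‖ ≤ ‖z‖ * ‖v‖ := by
    intro z hz
    have hclosed : IsClosed {z : lp (fun _ : ℕ => ℂ) 2 | ‖⟪z, w⟫_ℂ‖ ≤ ‖z‖ * ‖v‖} :=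
      isClosed_le (by fun_prop) (by fun_prop)
    refine closure_minimal ?_ hclosed hz
    rintro _ ⟨χ, rfl⟩
    have h1 : ⟪Finsupp.linearCombination ℂ (shiftedCreate α) χ, w⟫_ℂ
        = ⟪Finsupp.linearCombination ℂ
            (fun k => lp.single (E := fun _ : ℕ => ℂ) 2 k (1 : ℂ)) χ, v⟫_ℂ := by
      rw [Finsupp.linearCombination_apply, Finsupp.linearCombination_apply, Finsupp.sum,
        Finsupp.sum, sum_inner, sum_inner]
      refine Finset.sum_congr rfl fun k _ => ?_
      rw [inner_smul_left, inner_smul_left, hwv, lp.inner_single_left]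
      simp
    change ‖⟪_, w⟫_ℂ‖ ≤ _
    rw [h1]
    exact (norm_inner_le_norm _ _).trans
      (mul_le_mul_of_nonneg_right (linearCombination_shiftedCreate_norm_ge α χ) (norm_nonneg _))
  have hww := hbound w hmem
  rw [inner_self_eq_norm_sq_to_K, norm_pow] at hww
  simp only [RCLike.norm_ofReal, abs_norm] at hww
  have hle : ‖w‖ ≤ ‖v‖ := by
    by_contra hlt
    push Not at hlt
    nlinarith [norm_nonneg v]
  rw [hnorm]
  gcongr

theorem sqNorm_le_oneMode (α : ℂ) {u : ℕ → ℂ} (hu : sqNorm u ≠ ⊤) :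
    sqNorm u ≤ sqNorm (fun k : ℕ => (Real.sqrt (k + 1) : ℂ) * u (k + 1) - α * u k)
      + ‖∑' k, starRingEnd ℂ (coherentAmpOne α k) * u k‖ₑ ^ 2 := by
  set v : ℕ → ℂ := fun k : ℕ => (Real.sqrt (k + 1) : ℂ) * u (k + 1) - α * u k with hv
  by_cases hvt : sqNorm v = ⊤
  · simp [hvt]
  let C : lp (fun _ : ℕ => ℂ) 2 :=
    ⟨coherentAmpOne α, (memℓp_two_iff _).2 (by simp [sqNorm_coherentAmpOne])⟩
  let U : lp (fun _ : ℕ => ℂ) 2 := ⟨u, (memℓp_two_iff u).2 hu⟩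
  let V : lp (fun _ : ℕ => ℂ) 2 := ⟨v, (memℓp_two_iff v).2 hvt⟩
  have h := norm_sq_le_oneMode α C U V (fun _ => rfl) (fun _ => rfl)
  have hin : (∑' k, starRingEnd ℂ (coherentAmpOne α k) * u k) = ⟪C, U⟫_ℂ := by
    rw [lp.inner_eq_tsum]
    exact tsum_congr fun k => by simp [C, U, mul_comm]
  have hU : sqNorm u = ENNReal.ofReal (‖U‖ ^ 2) := sqNorm_coe U
  have hV : sqNorm v = ENNReal.ofReal (‖V‖ ^ 2) := sqNorm_coe V
  rw [hU, hV, hin, enorm_sq_eq_ofReal, ← ENNReal.ofReal_add (by positivity) (by positivity)]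
  exact ENNReal.ofReal_le_ofReal h

/-! ### The spectral gap of several modes -/

theorem hasSum_prod_apply {n : ℕ} (f : Fin n → ℕ → ℂ) (s : Fin n → ℂ)
    (hf : ∀ i, Summable fun k => ‖f i k‖) (hs : ∀ i, HasSum (f i) (s i)) :
    HasSum (fun m : Fin n → ℕ => ∏ i, f i (m i)) (∏ i, s i) := by
  induction n with
  | zero => simp
  | succ n ih =>
    have h := ih (fun i => f i.succ) (fun i => s i.succ) (fun i => hf i.succ) (fun i => hs i.succ)
    have hsm : Summable fun m : Fin n → ℕ => ‖∏ i, f i.succ (m i)‖ := by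
      simp_rw [norm_prod]
      exact summable_pi_prod (fun i k => ‖f i.succ k‖) (fun _ _ => norm_nonneg _)
        (fun i => hf i.succ)
    have hmul : Summable fun x : ℕ × (Fin n → ℕ) => f 0 x.1 * ∏ i : Fin n, f i.succ (x.2 i) :=
      summable_mul_of_summable_norm (g := fun m : Fin n → ℕ => ∏ i : Fin n, f i.succ (m i))
        (hf 0) hsm
    have h2 := (hs 0).mul h hmul
    rw [Fin.prod_univ_succ]
    refine ((Fin.consEquiv fun _ : Fin (n + 1) => ℕ).hasSum_iff).mp ?_
    refine (congrArg (fun f => HasSum f _) (funext fun x => ?_)).mpr h2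
    simp [Fin.consEquiv, Fin.prod_univ_succ]

theorem coherentAmp_eq_prod {n : ℕ} (α : Fin n → ℂ) (m : Fin n → ℕ) :
    coherentAmp α m = ∏ i, coherentAmpOne (α i) (m i) := rfl

theorem coherentAmp_cons {n : ℕ} (α : Fin (n + 1) → ℂ) (k : ℕ) (m : Fin n → ℕ) :
    coherentAmp α (Fin.cons k m)
      = coherentAmpOne (α 0) k * coherentAmp (fun i => α i.succ) m := by
  simp [coherentAmp_eq_prod, Fin.prod_univ_succ]

theorem norm_coherent {n : ℕ} (α : Fin n → ℂ) : ‖coherent α‖ = 1 := by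
  have h := lp.norm_rpow_eq_tsum (p := 2) (by simp) (coherent α)
  have h3 : (2 : ℝ≥0∞).toReal = ((2 : ℕ) : ℝ) := by simp
  simp_rw [h3, Real.rpow_natCast] at h
  have h1 : HasSum (fun m => ((‖coherent α m‖ ^ 2 : ℝ) : ℂ)) 1 := by
    have := hasSum_prod_apply (fun i k => ((‖coherentAmpOne (α i) k‖ ^ 2 : ℝ) : ℂ)) (fun _ => 1)
      (fun i => by
        refine (hasSum_norm_coherentAmpOne_sq (α i)).summable.congr fun k => ?_
        rw [Complex.norm_real, Real.norm_of_nonneg (by positivity)])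
      (fun i => by
        have := Complex.hasSum_ofReal.2 (hasSum_norm_coherentAmpOne_sq (α i))
        rwa [Complex.ofReal_one] at this)
    rw [Finset.prod_const_one] at this
    convert this using 2 with m
    change ((‖coherentAmp α m‖ ^ 2 : ℝ) : ℂ) = _
    rw [coherentAmp_eq_prod, norm_prod, ← Finset.prod_pow]
    push_cast
    rfl
  have h2 : HasSum (fun m => ‖coherent α m‖ ^ 2) 1 :=
    Complex.hasSum_ofReal.1 (by rwa [Complex.ofReal_one])
  rw [h2.tsum_eq] at h
  nlinarith [norm_nonneg (coherent α)]

theorem sqNorm_eq_tsum_cons {n : ℕ} (f : (Fin (n + 1) → ℕ) → ℂ) :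
    sqNorm f = ∑' m : Fin n → ℕ, sqNorm fun k : ℕ => f (Fin.cons k m) := by
  unfold sqNorm
  rw [← (Fin.consEquiv fun _ : Fin (n + 1) => ℕ).tsum_eq, ENNReal.tsum_prod', ENNReal.tsum_comm]
  rfl

theorem tsum_conj_coherentAmp_mul_cons {n : ℕ} (α : Fin (n + 1) → ℂ)
    {f : (Fin (n + 1) → ℕ) → ℂ} (hf : sqNorm f ≠ ⊤) :
    ∑' m, starRingEnd ℂ (coherentAmp α m) * f m
      = ∑' m : Fin n → ℕ, starRingEnd ℂ (coherentAmp (fun i => α i.succ) m)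
          * ∑' k : ℕ, starRingEnd ℂ (coherentAmpOne (α 0) k) * f (Fin.cons k m) := by
  let F : Fock (n + 1) := ⟨f, (memℓp_two_iff f).2 hf⟩
  have hs : Summable fun m => starRingEnd ℂ (coherentAmp α m) * f m := by
    refine (lp.summable_inner (𝕜 := ℂ) (coherent α) F).congr fun m => ?_
    simp [F, coherent, mul_comm]
  have hs2 := ((Equiv.prodComm (Fin n → ℕ) ℕ).trans
    (Fin.consEquiv fun _ : Fin (n + 1) => ℕ)).summable_iff.2 hs
  rw [← ((Equiv.prodComm (Fin n → ℕ) ℕ).trans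
    (Fin.consEquiv fun _ : Fin (n + 1) => ℕ)).tsum_eq]
  refine hs2.tsum_prod.trans ?_
  refine tsum_congr fun m => ?_
  rw [← tsum_mul_left]
  refine tsum_congr fun k => ?_
  simp only [Function.comp_apply, Equiv.trans_apply, Equiv.prodComm_apply, Prod.swap_prod_mk, Fin.consEquiv,
    Equiv.coe_fn_mk]
  rw [coherentAmp_cons, map_mul]
  ring

theorem summable_conj_coherentAmpOne_mul (α : ℂ) {u : ℕ → ℂ} (hu : sqNorm u ≠ ⊤) :
    Summable fun k => starRingEnd ℂ (coherentAmpOne α k) * u k := by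
  let C : lp (fun _ : ℕ => ℂ) 2 :=
    ⟨coherentAmpOne α, (memℓp_two_iff _).2 (by simp [sqNorm_coherentAmpOne])⟩
  let U : lp (fun _ : ℕ => ℂ) 2 := ⟨u, (memℓp_two_iff u).2 hu⟩
  refine (lp.summable_inner (𝕜 := ℂ) C U).congr fun k => ?_
  simp [C, U, mul_comm]

/-- Induction on the modes. The one-mode gap is applied to each slice in the first mode; what
remains is `g`, the partial inner product of `f` with the first coherent factor. That operation is a
contraction and commutes with the other annihilators, so the induction hypothesis for `g` gives the
remaining terms. -/
theorem sqNorm_le_sum_annihilate {n : ℕ} (α : Fin n → ℂ) {f : (Fin n → ℕ) → ℂ}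
    (hf : sqNorm f ≠ ⊤) :
    sqNorm f ≤ ∑ i, sqNorm (fun m => annihilate i f m - α i * f m)
      + ‖∑' m, starRingEnd ℂ (coherentAmp α m) * f m‖ₑ ^ 2 := by
  induction n with
  | zero => simp [sqNorm, coherentAmp]
  | succ n ih =>
    have hslice : ∀ m : Fin n → ℕ, sqNorm (fun k : ℕ => f (Fin.cons k m)) ≠ ⊤ := by
      rw [sqNorm_eq_tsum_cons] at hf
      exact fun m => ENNReal.ne_top_of_tsum_ne_top hf m
    set g : (Fin n → ℕ) → ℂ := fun m =>
      ∑' k : ℕ, starRingEnd ℂ (coherentAmpOne (α 0) k) * f (Fin.cons k m) with hg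
    have hgf : sqNorm g ≤ sqNorm f := by
      rw [sqNorm_eq_tsum_cons f]
      exact ENNReal.tsum_le_tsum fun m => enorm_tsum_conj_mul_sq_le (sqNorm_coherentAmpOne _).le
    have h1 : sqNorm f ≤ sqNorm (fun m => annihilate 0 f m - α 0 * f m) + sqNorm g := by
      rw [sqNorm_eq_tsum_cons f, sqNorm_eq_tsum_cons (fun m => annihilate 0 f m - α 0 * f m)]
      change _ ≤ _ + ∑' m, ‖g m‖ₑ ^ 2
      rw [← ENNReal.tsum_add]
      refine ENNReal.tsum_le_tsum fun m => ?_
      refine (sqNorm_le_oneMode (α 0) (hslice m)).trans_eq ?_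
      congr 2
      funext k
      simp [annihilate]
    have h2 := ih (fun i => α i.succ) (ne_top_of_le_ne_top hf hgf)
    rw [tsum_conj_coherentAmp_mul_cons α hf, Fin.sum_univ_succ, add_assoc]
    refine h1.trans (add_le_add le_rfl (h2.trans (add_le_add ?_ le_rfl)))
    refine Finset.sum_le_sum fun j _ => ?_
    rw [sqNorm_eq_tsum_cons]
    refine ENNReal.tsum_le_tsum fun m => ?_
    refine Eq.trans_le ?_ (enorm_tsum_conj_mul_sq_le (sqNorm_coherentAmpOne (α 0)).le)
    congr 2
    simp only [annihilate, hg]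
    rw [← tsum_mul_left, ← tsum_mul_left, ← Summable.tsum_sub]
    · refine tsum_congr fun k => ?_
      rw [Fin.cons_succ, ← Fin.cons_update]
      ring
    · exact (summable_conj_coherentAmpOne_mul (α 0) (hslice _)).mul_left _
    · exact (summable_conj_coherentAmpOne_mul (α 0) (hslice _)).mul_left _

/-! ### Ladder operators and quadratures -/

/-- Adding one excitation to the `i`-th mode. -/
def raise {n : ℕ} (i : Fin n) (m : Fin n → ℕ) : Fin n → ℕ := Function.update m i (m i + 1)

theorem raise_injective {n : ℕ} (i : Fin n) : Function.Injective (raise i) := by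
  intro m m' h
  funext j
  have hj := congrFun h j
  by_cases hij : j = i
  · subst hij
    simpa [raise] using hj
  · simpa [raise, hij] using hj

theorem mem_range_raise {n : ℕ} {i : Fin n} {m : Fin n → ℕ} (h : m i ≠ 0) :
    m ∈ Set.range (raise i) := by
  refine ⟨Function.update m i (m i - 1), ?_⟩
  have : m i - 1 + 1 = m i := by omega
  simp [raise, this]

theorem tsum_eq_tsum_raise {n : ℕ} {M : Type*} [AddCommMonoid M] [TopologicalSpace M] [T2Space M]
    (i : Fin n) (f : (Fin n → ℕ) → M) (hf : ∀ m, m i = 0 → f m = 0) :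
    ∑' m, f m = ∑' m, f (raise i m) :=
  ((raise_injective i).tsum_eq fun m hm => mem_range_raise fun h => hm (hf m h)).symm

@[simp] theorem create_raise {n : ℕ} (i : Fin n) (f : (Fin n → ℕ) → ℂ) (m : Fin n → ℕ) :
    create i f (raise i m) = (Real.sqrt (m i + 1) : ℂ) * f m := by
  simp [create, raise]

theorem create_of_eq_zero {n : ℕ} {i : Fin n} (f : (Fin n → ℕ) → ℂ) {m : Fin n → ℕ}
    (h : m i = 0) : create i f m = 0 := by
  simp [create, h]

theorem annihilate_eq {n : ℕ} (i : Fin n) (f : (Fin n → ℕ) → ℂ) (m : Fin n → ℕ) :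
    annihilate i f m = (Real.sqrt (m i + 1) : ℂ) * f (raise i m) := rfl

/-- Shifting the occupation number matches the terms one by one, so the adjoint relation needs no
summability. -/
theorem tsum_conj_create_mul {n : ℕ} (i : Fin n) (f g : (Fin n → ℕ) → ℂ) :
    ∑' m, starRingEnd ℂ (create i f m) * g m = ∑' m, starRingEnd ℂ (f m) * annihilate i g m := by
  rw [tsum_eq_tsum_raise i]
  · refine tsum_congr fun m => ?_
    rw [create_raise, annihilate_eq, map_mul, Complex.conj_ofReal]
    ring
  · intro m h
    simp [create_of_eq_zero f h]

theorem enorm_sqrt_sq (k : ℕ) : ‖(Real.sqrt k : ℂ)‖ₑ ^ 2 = k := by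
  rw [enorm_sq_eq_ofReal, Complex.norm_real, Real.norm_of_nonneg (Real.sqrt_nonneg _),
    Real.sq_sqrt (Nat.cast_nonneg _), ENNReal.ofReal_natCast]

/-- This is `a a† = a† a + 1` in the number basis, with weights `m_i + 1` and `m_i`. Being valid in
`[0, ∞]`, it shows that `aψ` and `a†ψ` are square summable together. -/
theorem sqNorm_create {n : ℕ} (i : Fin n) (f : (Fin n → ℕ) → ℂ) :
    sqNorm (create i f) = sqNorm (annihilate i f) + sqNorm f := by
  have h1 : sqNorm (create i f) = ∑' m, ((m i : ℝ≥0∞) + 1) * ‖f m‖ₑ ^ 2 := by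
    unfold sqNorm
    rw [tsum_eq_tsum_raise i]
    · refine tsum_congr fun m => ?_
      have := enorm_sqrt_sq (m i + 1)
      push_cast at this
      rw [create_raise, enorm_mul, mul_pow, this]
    · intro m h
      simp [create_of_eq_zero f h]
  have h2 : sqNorm (annihilate i f) = ∑' m, (m i : ℝ≥0∞) * ‖f m‖ₑ ^ 2 := by
    unfold sqNorm
    rw [tsum_eq_tsum_raise i (fun m => (m i : ℝ≥0∞) * ‖f m‖ₑ ^ 2)]
    · refine tsum_congr fun m => ?_
      have := enorm_sqrt_sq (m i + 1)
      push_cast at this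
      rw [annihilate_eq, enorm_mul, mul_pow, this]
      simp [raise]
    · intro m h
      simp [h]
  rw [h1, h2, sqNorm, ← ENNReal.tsum_add]
  exact tsum_congr fun m => by ring

theorem annihilate_create {n : ℕ} (i j : Fin n) (f : (Fin n → ℕ) → ℂ) (m : Fin n → ℕ) :
    annihilate i (create j f) m
      = create j (annihilate i f) m + if i = j then f m else 0 := by
  have hs : ∀ x : ℕ, ((Real.sqrt x : ℝ) : ℂ) * (Real.sqrt x : ℂ) = x := by
    intro x
    rw [← Complex.ofReal_mul, Real.mul_self_sqrt (Nat.cast_nonneg _)]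
    simp
  by_cases hij : i = j
  · subst hij
    rw [annihilate_eq, create_raise, if_pos rfl, ← mul_assoc]
    have h1 := hs (m i + 1)
    push_cast at h1
    rw [h1]
    by_cases hm : m i = 0
    · rw [create_of_eq_zero _ hm, hm]
      simp
    · obtain ⟨m, rfl⟩ := mem_range_raise hm
      rw [create_raise, annihilate_eq, ← mul_assoc]
      have h2 := hs (m i + 1)
      push_cast at h2
      rw [h2]
      simp [raise]
      ring
  · have hji : j ≠ i := fun h => hij h.symm
    simp only [annihilate, create, if_neg hij, add_zero]
    rw [Function.update_of_ne hji, Function.update_of_ne hij, Function.update_comm hij]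
    ring

theorem sqNorm_ne_top_iff_finiteMoments {n : ℕ} (ψ : Fock n) :
    HasFiniteSecondMoments ψ ↔ ∀ i, sqNorm (annihilate i (ψ : (Fin n → ℕ) → ℂ)) ≠ ⊤ := by
  have hsq : (Real.sqrt 2 : ℂ) * (Real.sqrt 2 : ℂ) = 2 := by
    rw [← Complex.ofReal_mul, Real.mul_self_sqrt (by norm_num)]
    simp
  have hne : (Real.sqrt 2 : ℂ) ≠ 0 := by
    intro h
    simp [h] at hsq
  constructor
  · intro h i
    rw [← memℓp_two_iff]
    -- This is `a = (x + i p) / √2`.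
    have h1 := ((h (i, 0)).add ((h (i, 1)).const_smul Complex.I)).const_smul
      (1 / (Real.sqrt 2 : ℂ))
    convert h1 using 1
    funext m
    simp only [quadratureAmp, Pi.smul_apply, Pi.add_apply, smul_eq_mul]
    simp
    field_simp
    linear_combination (annihilate i (ψ : (Fin n → ℕ) → ℂ) m) * hsq
  · intro h s
    have hψ := (memℓp_two_iff _).1 (lp.memℓp ψ)
    have hA := (memℓp_two_iff _).2 (h s.1)
    have hC : Memℓp (E := fun _ : Fin n → ℕ => ℂ) (create s.1 (ψ : (Fin n → ℕ) → ℂ)) 2 := by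
      rw [memℓp_two_iff, sqNorm_create]
      exact ENNReal.add_ne_top.2 ⟨h s.1, hψ⟩
    by_cases hs : s.2 = 0
    · convert (hA.add hC).const_smul (1 / (Real.sqrt 2 : ℂ)) using 1
      funext m
      simp [quadratureAmp, hs]
      ring
    · convert (hA.sub hC).const_smul (1 / ((Real.sqrt 2 : ℂ) * Complex.I)) using 1
      funext m
      simp only [quadratureAmp, hs, if_false, Pi.smul_apply, Pi.sub_apply, smul_eq_mul]
      ring

/-- The vectors `A_i = a_i ψ` and `C_i = a_i† ψ` for `ψ` with finite second moments. -/
structure LadderVectors {n : ℕ} (ψ : Fock n) (A C : Fin n → Fock n) : Prop where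
  annihilate_eq : ∀ i, (A i : (Fin n → ℕ) → ℂ) = annihilate i ψ
  create_eq : ∀ i, (C i : (Fin n → ℕ) → ℂ) = create i ψ

namespace LadderVectors

variable {n : ℕ} {ψ : Fock n} {A C : Fin n → Fock n}

theorem _root_.BosonicModes.HasFiniteSecondMoments.exists_ladderVectors
    (h : HasFiniteSecondMoments ψ) : ∃ A C, LadderVectors ψ A C := by
  rw [sqNorm_ne_top_iff_finiteMoments] at h
  have hC : ∀ i, Memℓp (E := fun _ : Fin n → ℕ => ℂ) (create i (ψ : (Fin n → ℕ) → ℂ)) 2 := by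
    intro i
    rw [memℓp_two_iff, sqNorm_create]
    exact ENNReal.add_ne_top.2 ⟨h i, (memℓp_two_iff _).1 (lp.memℓp ψ)⟩
  exact ⟨fun i => ⟨_, (memℓp_two_iff _).2 (h i)⟩, fun i => ⟨_, hC i⟩, fun _ => rfl, fun _ => rfl⟩

theorem finiteMoments (h : LadderVectors ψ A C) : HasFiniteSecondMoments ψ := by
  rw [sqNorm_ne_top_iff_finiteMoments]
  intro i
  rw [← h.annihilate_eq, ← memℓp_two_iff]
  exact lp.memℓp _

theorem norm_create_sq (h : LadderVectors ψ A C) (i : Fin n) :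
    ‖C i‖ ^ 2 = ‖A i‖ ^ 2 + ‖ψ‖ ^ 2 := by
  have h1 := sqNorm_create i (ψ : (Fin n → ℕ) → ℂ)
  rw [← h.annihilate_eq, ← h.create_eq, sqNorm_coe, sqNorm_coe, sqNorm_coe,
    ← ENNReal.ofReal_add (by positivity) (by positivity)] at h1
  exact (ENNReal.ofReal_eq_ofReal_iff (by positivity) (by positivity)).1 h1

theorem inner_create (h : LadderVectors ψ A C) (i : Fin n) {φ χ : Fock n}
    (hχ : ∀ m, χ m = annihilate i φ m) : ⟪C i, φ⟫_ℂ = ⟪ψ, χ⟫_ℂ := by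
  rw [lp.inner_eq_tsum, lp.inner_eq_tsum]
  have := tsum_conj_create_mul i (ψ : (Fin n → ℕ) → ℂ) φ
  simp only [RCLike.inner_apply, hχ, h.create_eq, mul_comm _ (starRingEnd ℂ _)]
  exact this

theorem quadrature_zero (h : LadderVectors ψ A C) (i : Fin n) :
    quadrature (i, 0) ψ = (1 / (Real.sqrt 2 : ℂ)) • (A i + C i) := by
  rw [quadrature, dif_pos (h.finiteMoments (i, 0))]
  ext m
  rw [lp.coeFn_smul, Pi.smul_apply, lp.coeFn_add, Pi.add_apply, h.annihilate_eq, h.create_eq]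
  simp [quadratureAmp]
  ring

theorem quadrature_one (h : LadderVectors ψ A C) (i : Fin n) :
    quadrature (i, 1) ψ = (1 / ((Real.sqrt 2 : ℂ) * Complex.I)) • (A i - C i) := by
  rw [quadrature, dif_pos (h.finiteMoments (i, 1))]
  ext m
  rw [lp.coeFn_smul, Pi.smul_apply, lp.coeFn_sub, Pi.sub_apply, h.annihilate_eq, h.create_eq]
  simp only [quadratureAmp, smul_eq_mul, Fin.isValue, one_ne_zero, if_false]
  ring

theorem inner_self_create (h : LadderVectors ψ A C) (i : Fin n) :
    ⟪ψ, C i⟫_ℂ = starRingEnd ℂ ⟪ψ, A i⟫_ℂ := by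
  rw [← h.inner_create i (φ := ψ) (χ := A i) (fun m => by rw [h.annihilate_eq]), inner_conj_symm]

end LadderVectors

/-- The excess `V(ψ) - I/2` of the covariance matrix over that of coherent states. -/
def excess {n : ℕ} (ψ : Fock n) : Matrix (Fin n × Fin 2) (Fin n × Fin 2) ℝ :=
  covariance ψ - (1 / 2 : ℝ) • 1

/-- By the parallelogram law the two second moments sum to `‖aψ‖² + ‖a†ψ‖² = 2‖aψ‖² + 1`. The
squared means sum to `2|⟨a⟩|²`, and the subtracted `I/2` removes the 1. -/
theorem LadderVectors.excess_mode {n : ℕ} {ψ : Fock n} {A C : Fin n → Fock n}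
    (h : LadderVectors ψ A C) (hψ : ‖ψ‖ = 1) (i : Fin n) :
    excess ψ (i, 0) (i, 0) + excess ψ (i, 1) (i, 1) = 2 * ‖A i - ⟪ψ, A i⟫_ℂ • ψ‖ ^ 2 := by
  have hnorm : ‖A i - ⟪ψ, A i⟫_ℂ • ψ‖ ^ 2 = ‖A i‖ ^ 2 - ‖⟪ψ, A i⟫_ℂ‖ ^ 2 := by
    rw [@norm_sub_sq ℂ, inner_smul_right, norm_smul, hψ, ← inner_conj_symm (A i) ψ,
      Complex.mul_conj, Complex.normSq_eq_norm_sq]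
    simp only [RCLike.re_to_complex, Complex.ofReal_re]
    ring
  have hC := h.norm_create_sq i
  have hpar := parallelogram_law_with_norm ℂ (A i) (C i)
  have hs2 : ‖(Real.sqrt 2 : ℂ)‖ ^ 2 = 2 := by
    rw [Complex.norm_real, Real.norm_of_nonneg (Real.sqrt_nonneg _), Real.sq_sqrt (by norm_num)]
  have hss : Real.sqrt 2 * Real.sqrt 2 = 2 := Real.mul_self_sqrt (by norm_num)
  have hre : ∀ v : Fock n, (⟪v, v⟫_ℂ).re = ‖v‖ ^ 2 := fun v => by
    rw [← inner_self_eq_norm_sq (𝕜 := ℂ) v]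
    rfl
  have hx : (⟪quadrature (i, 0) ψ, quadrature (i, 0) ψ⟫_ℂ).re = ‖A i + C i‖ ^ 2 / 2 := by
    rw [hre, h.quadrature_zero, norm_smul, norm_div, norm_one, mul_pow, div_pow, hs2]
    ring
  have hp : (⟪quadrature (i, 1) ψ, quadrature (i, 1) ψ⟫_ℂ).re = ‖A i - C i‖ ^ 2 / 2 := by
    rw [hre, h.quadrature_one, norm_smul, norm_div, norm_mul, Complex.norm_I, norm_one, mul_one,
      mul_pow, div_pow, hs2]
    ring
  have hmx : (⟪ψ, quadrature (i, 0) ψ⟫_ℂ).re = Real.sqrt 2 * (⟪ψ, A i⟫_ℂ).re := by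
    rw [h.quadrature_zero, inner_smul_right, inner_add_right, h.inner_self_create,
      Complex.add_conj, one_div, ← Complex.ofReal_inv, ← Complex.ofReal_mul, Complex.ofReal_re]
    field_simp
    linear_combination (-(⟪ψ, A i⟫_ℂ).re) * hss
  have hmp : (⟪ψ, quadrature (i, 1) ψ⟫_ℂ).re = Real.sqrt 2 * (⟪ψ, A i⟫_ℂ).im := by
    rw [h.quadrature_one, inner_smul_right, inner_sub_right, h.inner_self_create,
      Complex.sub_conj]
    have : 1 / ((Real.sqrt 2 : ℂ) * Complex.I) * ((2 * (⟪ψ, A i⟫_ℂ).im : ℝ) * Complex.I)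
        = ((1 / Real.sqrt 2 * (2 * (⟪ψ, A i⟫_ℂ).im) : ℝ) : ℂ) := by
      have h1 : (Real.sqrt 2 : ℂ) ≠ 0 := by
        exact_mod_cast (Real.sqrt_pos.2 (by norm_num : (0 : ℝ) < 2)).ne'
      have h2 := Complex.I_ne_zero
      push_cast
      field_simp
    rw [this, Complex.ofReal_re]
    field_simp
    linear_combination (-(⟪ψ, A i⟫_ℂ).im) * hss
  have hn2 : ‖⟪ψ, A i⟫_ℂ‖ ^ 2 = (⟪ψ, A i⟫_ℂ).re ^ 2 + (⟪ψ, A i⟫_ℂ).im ^ 2 := by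
    rw [← Complex.normSq_eq_norm_sq, Complex.normSq_apply]
    ring
  simp only [excess, Matrix.sub_apply, covariance, Matrix.of_apply, Matrix.smul_apply,
    Matrix.one_apply_eq, smul_eq_mul, hx, hp, hmx, hmp, hnorm, hn2]
  rw [hψ] at hC
  linear_combination (1 / 2 : ℝ) * hpar + hC
    - ((⟪ψ, A i⟫_ℂ).re ^ 2 + (⟪ψ, A i⟫_ℂ).im ^ 2) * hss

theorem excess_mode_nonneg {n : ℕ} {ψ : Fock n} (hψ : ‖ψ‖ = 1) (h : HasFiniteSecondMoments ψ)
    (i : Fin n) : 0 ≤ excess ψ (i, 0) (i, 0) + excess ψ (i, 1) (i, 1) := by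
  obtain ⟨A, C, hAC⟩ := h.exists_ladderVectors
  rw [hAC.excess_mode hψ]
  positivity

/-- The coherent state with the mean amplitudes of `ψ` overlaps with `ψ` up to half the trace of
the excess of the covariance matrix. -/
theorem exists_coherent_overlap {n : ℕ} {ψ : Fock n} (hψ : ‖ψ‖ = 1)
    (h : HasFiniteSecondMoments ψ) :
    ∃ α : Fin n → ℂ, 1 - ‖⟪coherent α, ψ⟫_ℂ‖ ^ 2
      ≤ 1 / 2 * ∑ i, (excess ψ (i, 0) (i, 0) + excess ψ (i, 1) (i, 1)) := by
  obtain ⟨A, C, hAC⟩ := h.exists_ladderVectors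
  refine ⟨fun i => ⟪ψ, A i⟫_ℂ, ?_⟩
  have h1 := sqNorm_le_sum_annihilate (fun i => ⟪ψ, A i⟫_ℂ) ((memℓp_two_iff _).1 (lp.memℓp ψ))
  have h2 : ∀ i, sqNorm (fun m => annihilate i (ψ : (Fin n → ℕ) → ℂ) m - ⟪ψ, A i⟫_ℂ * ψ m)
      = ENNReal.ofReal (‖A i - ⟪ψ, A i⟫_ℂ • ψ‖ ^ 2) := by
    intro i
    rw [← sqNorm_coe]
    congr 1
    funext m
    rw [← hAC.annihilate_eq]
    rfl
  have h3 : ∑' m, starRingEnd ℂ (coherentAmp (fun i => ⟪ψ, A i⟫_ℂ) m) * ψ m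
      = ⟪coherent (fun i => ⟪ψ, A i⟫_ℂ), ψ⟫_ℂ := by
    rw [lp.inner_eq_tsum]
    exact tsum_congr fun m => by simp [coherent, mul_comm]
  rw [h3, sqNorm_coe, hψ, enorm_sq_eq_ofReal] at h1
  simp_rw [h2] at h1
  rw [← ENNReal.ofReal_sum_of_nonneg (fun _ _ => by positivity),
    ← ENNReal.ofReal_add (Finset.sum_nonneg fun _ _ => by positivity) (by positivity),
    ENNReal.ofReal_le_ofReal_iff
      (add_nonneg (Finset.sum_nonneg fun _ _ => by positivity) (by positivity))] at h1
  simp_rw [hAC.excess_mode hψ, ← Finset.mul_sum]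
  linarith

/-! ### Second moments of coherent states -/

theorem annihilate_coherentAmp {n : ℕ} (α : Fin n → ℂ) (i : Fin n) (m : Fin n → ℕ) :
    annihilate i (coherentAmp α) m = α i * coherentAmp α m := by
  rw [annihilate_eq, coherentAmp_eq_prod, coherentAmp_eq_prod,
    ← Finset.mul_prod_erase _ _ (Finset.mem_univ i),
    ← Finset.mul_prod_erase Finset.univ (fun j => coherentAmpOne (α j) (m j)) (Finset.mem_univ i),
    ← mul_assoc, ← mul_assoc]
  congr 1
  · simp only [raise, Function.update_self]
    exact sqrt_succ_mul_coherentAmpOne _ _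
  · refine Finset.prod_congr rfl fun j hj => ?_
    rw [raise, Function.update_of_ne (Finset.ne_of_mem_erase hj)]

theorem exists_ladderVectors_coherent {n : ℕ} (α : Fin n → ℂ) :
    ∃ C, LadderVectors (coherent α) (fun i => α i • coherent α) C := by
  have hA : ∀ i, annihilate i (coherentAmp α) = ((α i • coherent α : Fock n) : (Fin n → ℕ) → ℂ) :=
    fun i => funext fun m => annihilate_coherentAmp α i m
  have hm : HasFiniteSecondMoments (coherent α) := by
    rw [sqNorm_ne_top_iff_finiteMoments]
    intro i
    change sqNorm (annihilate i (coherentAmp α)) ≠ ⊤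
    rw [hA, ← memℓp_two_iff]
    exact lp.memℓp _
  obtain ⟨A, C, h⟩ := hm.exists_ladderVectors
  exact ⟨C, fun i => (hA i).symm, h.create_eq⟩

theorem finiteMoments_coherent {n : ℕ} (α : Fin n → ℂ) : HasFiniteSecondMoments (coherent α) := by
  obtain ⟨C, h⟩ := exists_ladderVectors_coherent α
  exact h.finiteMoments

/-- Since `aψ = αψ`, all second moments factor into means except `⟨a a†⟩`, which gains 1 from the
commutator. This leaves `1/2` on the diagonal; the commutator of `x` and `p` is imaginary and drops
out of the real part. -/
theorem excess_coherent {n : ℕ} (α : Fin n → ℂ) : excess (coherent α) = 0 := by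
  obtain ⟨C, h⟩ := exists_ladderVectors_coherent α
  set ψ := coherent α with hψ
  have hψψ : ⟪ψ, ψ⟫_ℂ = 1 := by
    rw [inner_self_eq_norm_sq_to_K, norm_coherent]
    simp
  have hψC : ∀ i, ⟪ψ, C i⟫_ℂ = starRingEnd ℂ (α i) := by
    intro i
    rw [h.inner_self_create, inner_smul_right, hψψ, mul_one]
  have hCψ : ∀ i, ⟪C i, ψ⟫_ℂ = α i := by
    intro i
    rw [← inner_conj_symm, hψC, Complex.conj_conj]
  have hCC : ∀ i j, ⟪C i, C j⟫_ℂ = α i * starRingEnd ℂ (α j) + if i = j then 1 else 0 := by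
    intro i j
    -- The witness `χ` is `a_i a_j† ψ`, put in normal order by `annihilate_create`.
    rw [h.inner_create i (φ := C j) (χ := α i • C j + (if i = j then (1 : ℂ) else 0) • ψ)]
    · rw [inner_add_right, inner_smul_right, inner_smul_right, hψC, hψψ, mul_one]
    · intro m
      rw [h.create_eq, annihilate_create, ← h.annihilate_eq]
      rw [lp.coeFn_add, lp.coeFn_smul, lp.coeFn_smul, Pi.add_apply, Pi.smul_apply, Pi.smul_apply,
        h.create_eq]
      simp only [create, lp.coeFn_smul, Pi.smul_apply, smul_eq_mul]
      split_ifs <;> ring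
  have hss : Real.sqrt 2 * Real.sqrt 2 = 2 := Real.mul_self_sqrt (by norm_num)
  have hI : 1 / ((Real.sqrt 2 : ℂ) * Complex.I) = (1 / (Real.sqrt 2 : ℂ)) * (-Complex.I) := by
    rw [one_div, mul_inv, Complex.inv_I, one_div]
  have hr : 1 / (Real.sqrt 2 : ℂ) = ((1 / Real.sqrt 2 : ℝ) : ℂ) := by push_cast; rfl
  have hrr : 1 / Real.sqrt 2 * (1 / Real.sqrt 2) = 1 / 2 := by
    rw [div_mul_div_comm, hss, one_mul]
  set r := 1 / Real.sqrt 2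
  ext ⟨i, a⟩ ⟨j, b⟩
  simp only [excess, Matrix.sub_apply, covariance, Matrix.of_apply, Matrix.smul_apply,
    Matrix.zero_apply, Matrix.one_apply, Prod.mk.injEq]
  fin_cases a <;> fin_cases b <;>
  · simp only [Fin.zero_eta, Fin.mk_one, Fin.isValue, h.quadrature_zero, h.quadrature_one, hI, hr,
      inner_smul_left, inner_smul_right, inner_add_left, inner_add_right, inner_sub_left,
      inner_sub_right, hCC, hψC, hCψ, hψψ, map_mul, map_neg, Complex.conj_ofReal, Complex.conj_I]
    by_cases hij : i = j
    · simp [hij]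
      grind
    · simp [hij]
      grind

/-! ### Traces on coordinate subspaces -/

/-- The subspace spanned by the coordinate axes in `A`. -/
def coordSubspace {n : ℕ} (A : Finset (Fin n × Fin 2)) : Submodule ℝ (PhaseSpace n) :=
  Submodule.span ℝ ((fun s => EuclideanSpace.single s (1 : ℝ)) '' (A : Set (Fin n × Fin 2)))

theorem orthonormal_single_subtype {n : ℕ} (A : Finset (Fin n × Fin 2)) :
    Orthonormal ℝ fun s : A => (EuclideanSpace.single (s : Fin n × Fin 2) (1 : ℝ) : PhaseSpace n) :=
  (EuclideanSpace.orthonormal_single).comp _ Subtype.val_injective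

theorem coordSubspace_eq_span_range {n : ℕ} (A : Finset (Fin n × Fin 2)) :
    coordSubspace A = Submodule.span ℝ (Set.range fun s : A =>
      (EuclideanSpace.single (s : Fin n × Fin 2) (1 : ℝ) : PhaseSpace n)) := by
  rw [coordSubspace]
  congr 1
  ext v
  simp

/-- The orthonormal basis of a coordinate subspace. -/
def coordBasis {n : ℕ} (A : Finset (Fin n × Fin 2)) :
    OrthonormalBasis A ℝ (coordSubspace A) :=
  let b := Module.Basis.span (orthonormal_single_subtype A).linearIndependent
  (b.map (LinearEquiv.ofEq _ _ (coordSubspace_eq_span_range A).symm)).toOrthonormalBasis (by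
    have h := orthonormal_single_subtype A
    rw [orthonormal_iff_ite] at h ⊢
    intro i j
    rw [← h i j, Submodule.coe_inner]
    simp [b, Module.Basis.span_apply])

theorem coordBasis_apply {n : ℕ} (A : Finset (Fin n × Fin 2)) (s : A) :
    (coordBasis A s : PhaseSpace n) = EuclideanSpace.single (s : Fin n × Fin 2) (1 : ℝ) := by
  simp [coordBasis, Module.Basis.span_apply]

theorem finrank_coordSubspace {n : ℕ} (A : Finset (Fin n × Fin 2)) :
    Module.finrank ℝ (coordSubspace A) = A.card := by
  rw [Module.finrank_eq_card_basis (coordBasis A).toBasis, Fintype.card_coe]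

theorem traceOn_coordSubspace {n : ℕ} (A : Finset (Fin n × Fin 2))
    (M : Matrix (Fin n × Fin 2) (Fin n × Fin 2) ℝ) :
    traceOn (coordSubspace A) M = ∑ s ∈ A, M s s := by
  rw [traceOn, LinearMap.trace_eq_sum_inner _ (coordBasis A), ← Finset.sum_coe_sort A]
  refine Finset.sum_congr rfl fun s _ => ?_
  rw [Submodule.coe_inner]
  simp only [LinearMap.comp_apply, Submodule.subtype_apply, coordBasis_apply]
  have : ∀ v : PhaseSpace n, ⟪(EuclideanSpace.single (s : Fin n × Fin 2) (1 : ℝ) : PhaseSpace n),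
      ((coordSubspace A).orthogonalProjectionOnto v : PhaseSpace n)⟫_ℝ = v s := by
    intro v
    rw [← coordBasis_apply A s, ← Submodule.coe_inner,
      Submodule.inner_orthogonalProjectionOnto_eq_of_mem_left, coordBasis_apply]
    simp [EuclideanSpace.inner_single_left]
  refine (this _).trans ?_
  simp [Matrix.toEuclideanLin]

/-- Deleting a smallest element never lowers the average; starting from all of `s`, this is repeated
until `k` elements remain. Cross-multiplication avoids dividing by `k`. -/
theorem exists_subset_card_mul_sum_ge {ι : Type*} [DecidableEq ι] (s : Finset ι) (d : ι → ℝ)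
    (k : ℕ) (hk : k ≤ s.card) :
    ∃ A ⊆ s, A.card = k ∧ (k : ℝ) * ∑ i ∈ s, d i ≤ s.card * ∑ i ∈ A, d i := by
  induction hk using Nat.decreasingInduction with
  | self => exact ⟨s, subset_rfl, rfl, le_rfl⟩
  | of_succ k hk ih =>
    obtain ⟨A, hA, hcard, hsum⟩ := ih
    have hne : A.Nonempty := Finset.card_pos.1 (by omega)
    obtain ⟨a, ha, hmin⟩ := A.exists_min_image d hne
    refine ⟨A.erase a, (Finset.erase_subset _ _).trans hA, ?_, ?_⟩
    · rw [Finset.card_erase_of_mem ha, hcard]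
      rfl
    · have h1 := Finset.add_sum_erase A d ha
      have h2 : (k : ℝ) * d a ≤ ∑ i ∈ A.erase a, d i := by
        have := Finset.card_nsmul_le_sum (A.erase a) d (d a)
          fun i hi => hmin i (Finset.mem_of_mem_erase hi)
        rwa [Finset.card_erase_of_mem ha, hcard, nsmul_eq_mul, Nat.add_sub_cancel] at this
      have hs : (0 : ℝ) ≤ s.card := Nat.cast_nonneg _
      push_cast at hsum
      have h3 : (k : ℝ) * ∑ i ∈ A, d i ≤ (k + 1) * ∑ i ∈ A.erase a, d i := by
        rw [← h1]
        linarith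
      have hk0 : (0 : ℝ) < k + 1 := by positivity
      have h4 : ((k : ℝ) + 1) * (k * ∑ i ∈ s, d i)
          ≤ (k + 1) * (s.card * ∑ i ∈ A.erase a, d i) :=
        calc ((k : ℝ) + 1) * (k * ∑ i ∈ s, d i) = k * ((k + 1) * ∑ i ∈ s, d i) := by ring
          _ ≤ k * (s.card * ∑ i ∈ A, d i) := by gcongr
          _ = s.card * (k * ∑ i ∈ A, d i) := by ring
          _ ≤ s.card * ((k + 1) * ∑ i ∈ A.erase a, d i) := by gcongr
          _ = _ := by ring
      exact le_of_mul_le_mul_left h4 hk0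

/-! ### Subspaces of modes -/

/-- The matrix permuting the modes by `σ`. -/
def modePerm {n : ℕ} (σ : Equiv.Perm (Fin n)) : Matrix (Fin n × Fin 2) (Fin n × Fin 2) ℝ :=
  (1 : Matrix (Fin n × Fin 2) (Fin n × Fin 2) ℝ).submatrix id fun s => (σ s.1, s.2)

theorem modePerm_apply {n : ℕ} (σ : Equiv.Perm (Fin n)) (s t : Fin n × Fin 2) :
    modePerm σ s t = if s = (σ t.1, t.2) then 1 else 0 := by
  simp [modePerm, Matrix.one_apply]

/-- Permuting modes while keeping each pair `(x, p)` together is orthogonal and symplectic. -/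
theorem isModeSubspace_coordSubspace {n : ℕ} (σ : Equiv.Perm (Fin n)) (k : ℕ) :
    IsModeSubspace k (coordSubspace
      (Finset.univ.filter fun s : Fin n × Fin 2 => ((σ.symm s.1 : Fin n) : ℕ) < k)) := by
  have hl : (modePerm σ).transpose * modePerm σ = 1 := by
    ext s t
    simp only [Matrix.mul_apply, Matrix.transpose_apply, modePerm_apply, ite_mul, one_mul, zero_mul,
      Finset.sum_ite_eq', Finset.mem_univ, if_true, Matrix.one_apply]
    simp [Prod.ext_iff]
  refine ⟨modePerm σ, hl, mul_eq_one_comm.1 hl, ?_, ?_⟩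
  · ext s t
    simp only [Matrix.mul_apply, Matrix.transpose_apply, modePerm_apply, ite_mul, mul_ite, one_mul,
      zero_mul, mul_one, mul_zero, Finset.sum_ite_eq', Finset.mem_univ, if_true]
    simp [symplecticForm, Matrix.one_apply]
  · rw [coordSubspace, canonicalSubspace, Submodule.map_span]
    congr 1
    have hsingle : ∀ s : Fin n × Fin 2,
        Matrix.toEuclideanLin (modePerm σ) (EuclideanSpace.single s (1 : ℝ))
          = EuclideanSpace.single (σ s.1, s.2) (1 : ℝ) := by
      intro s
      ext t
      simp [Matrix.toEuclideanLin, modePerm_apply]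
    ext v
    constructor
    · rintro ⟨s, hs, rfl⟩
      refine ⟨EuclideanSpace.single (σ.symm s.1, s.2) 1, ⟨_, by simpa using hs, rfl⟩, ?_⟩
      rw [hsingle]
      simp
    · rintro ⟨_, ⟨s, hs, rfl⟩, rfl⟩
      exact ⟨(σ s.1, s.2), by simpa using hs, (hsingle s).symm⟩

/-! ### Bounds on the phase-space variances -/

theorem traceOn_le_varV {n k : ℕ} {ψ : Fock n} (h : HasFiniteSecondMoments ψ)
    {T : Submodule ℝ (PhaseSpace n)} (hT : Module.finrank ℝ T = k) :
    ((traceOn T (excess ψ) : ℝ) : EReal) ≤ varV k ψ := by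
  rw [varV, if_pos h]
  exact le_iSup₂_of_le T hT le_rfl

theorem traceOn_le_varW {n k : ℕ} {ψ : Fock n} (h : HasFiniteSecondMoments ψ)
    {S : Submodule ℝ (PhaseSpace n)} (hS : IsModeSubspace k S) :
    ((traceOn S (excess ψ) : ℝ) : EReal) ≤ varW k ψ := by
  rw [varW, if_pos h]
  exact le_iSup₂_of_le S hS le_rfl

theorem varV_coherent_le {n : ℕ} (k : ℕ) (α : Fin n → ℂ) : varV k (coherent α) ≤ 0 := by
  rw [varV, if_pos (finiteMoments_coherent α)]
  refine iSup₂_le fun T _ => ?_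
  change ((traceOn T (excess (coherent α)) : ℝ) : EReal) ≤ 0
  rw [excess_coherent]
  simp [traceOn]

theorem varW_coherent_le {n : ℕ} (k : ℕ) (α : Fin n → ℂ) : varW k (coherent α) ≤ 0 := by
  rw [varW, if_pos (finiteMoments_coherent α)]
  refine iSup₂_le fun T _ => ?_
  change ((traceOn T (excess (coherent α)) : ℝ) : EReal) ≤ 0
  rw [excess_coherent]
  simp [traceOn]

/-- Half the trace of the excess of the covariance matrix. -/
def meanExcess {n : ℕ} (ψ : Fock n) : ℝ :=
  1 / 2 * ∑ i, (excess ψ (i, 0) (i, 0) + excess ψ (i, 1) (i, 1))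

theorem meanExcess_nonneg {n : ℕ} {ψ : Fock n} (hψ : ‖ψ‖ = 1) (h : HasFiniteSecondMoments ψ) :
    0 ≤ meanExcess ψ :=
  mul_nonneg (by norm_num) (Finset.sum_nonneg fun i _ => excess_mode_nonneg hψ h i)

theorem exists_traceOn_ge_of_finrank {n k : ℕ} {ψ : Fock n} (hψ : ‖ψ‖ = 1)
    (h : HasFiniteSecondMoments ψ) (hk : 1 ≤ k) (hkn : k ≤ 2 * n) :
    ∃ T : Submodule ℝ (PhaseSpace n), Module.finrank ℝ T = k ∧
      meanExcess ψ ≤ n * traceOn T (excess ψ) := by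
  have hcard : (Finset.univ : Finset (Fin n × Fin 2)).card = n * 2 := by simp
  obtain ⟨A, -, hA, hsum⟩ := exists_subset_card_mul_sum_ge Finset.univ (fun s => excess ψ s s) k
    (by rw [hcard]; omega)
  refine ⟨coordSubspace A, by rw [finrank_coordSubspace, hA], ?_⟩
  rw [traceOn_coordSubspace]
  have h0 := meanExcess_nonneg hψ h
  have h1 : ∑ s, excess ψ s s = 2 * meanExcess ψ := by
    rw [meanExcess, Fintype.sum_prod_type]
    simp only [Fin.sum_univ_two]
    ring
  rw [h1, hcard] at hsum
  push_cast at hsum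
  have hk' : (1 : ℝ) ≤ k := by exact_mod_cast hk
  -- The chosen subset satisfies `k · meanExcess ≤ n · tr_T`; `k ≥ 1` and `meanExcess ≥ 0` allow `k`
  -- to be dropped.
  nlinarith

theorem exists_traceOn_ge_of_modes {n k : ℕ} {ψ : Fock n} (hψ : ‖ψ‖ = 1)
    (h : HasFiniteSecondMoments ψ) (hk : 1 ≤ k) (hkn : k ≤ n) :
    ∃ S : Submodule ℝ (PhaseSpace n), IsModeSubspace k S ∧
      meanExcess ψ ≤ n * traceOn S (excess ψ) := by
  set d : Fin n → ℝ := fun i => excess ψ (i, 0) (i, 0) + excess ψ (i, 1) (i, 1) with hd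
  have hd0 : ∀ i, 0 ≤ d i := excess_mode_nonneg hψ h
  let z : Fin n := ⟨0, by omega⟩
  obtain ⟨i₀, -, hmax⟩ := Finset.univ.exists_max_image d ⟨z, Finset.mem_univ _⟩
  -- The swap puts the mode of largest excess among the first `k`; the other `k - 1` modes
  -- contribute nonnegatively.
  refine ⟨_, isModeSubspace_coordSubspace (Equiv.swap z i₀) k, ?_⟩
  have h1 : ∑ i, d i ≤ n * d i₀ := by
    have := Finset.sum_le_card_nsmul Finset.univ d (d i₀) fun i hi => hmax i hi
    simpa using this
  have h2 : d i₀ ≤ traceOn (coordSubspace (Finset.univ.filter fun s : Fin n × Fin 2 =>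
      (((Equiv.swap z i₀).symm s.1 : Fin n) : ℕ) < k)) (excess ψ) := by
    have h3 : ∑ s ∈ Finset.univ.filter (fun s : Fin n × Fin 2 =>
          (((Equiv.swap z i₀).symm s.1 : Fin n) : ℕ) < k), excess ψ s s
        = ∑ i ∈ Finset.univ.filter (fun i : Fin n =>
            (((Equiv.swap z i₀).symm i : Fin n) : ℕ) < k), d i := by
      rw [Finset.sum_filter, Finset.sum_filter, Fintype.sum_prod_type]
      refine Finset.sum_congr rfl fun i _ => ?_
      simp only [Fin.sum_univ_two]
      split_ifs <;> simp [hd]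
    rw [traceOn_coordSubspace, h3]
    refine Finset.single_le_sum (fun i _ => hd0 i) ?_
    refine Finset.mem_filter.2 ⟨Finset.mem_univ _, ?_⟩
    rw [Equiv.symm_swap, Equiv.swap_apply_right]
    exact hk
  have hn : (0 : ℝ) ≤ n := Nat.cast_nonneg n
  have h4 := mul_le_mul_of_nonneg_left h2 hn
  have h5 : meanExcess ψ = 1 / 2 * ∑ i, d i := rfl
  have h6 := mul_nonneg hn (hd0 i₀)
  linarith

theorem nonneg_of_meanExcess_le {n : ℕ} (hn : 1 ≤ n) {ψ : Fock n} (hψ : ‖ψ‖ = 1)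
    (h : HasFiniteSecondMoments ψ) {t : ℝ} (ht : meanExcess ψ ≤ n * t) : 0 ≤ t := by
  have h0 := (meanExcess_nonneg hψ h).trans ht
  have hn' : (0 : ℝ) < n := by exact_mod_cast hn
  exact nonneg_of_mul_nonneg_right h0 hn'

theorem varV_nonneg {n k : ℕ} {ψ : Fock n} (hψ : ‖ψ‖ = 1) (hk : 1 ≤ k) (hkn : k ≤ 2 * n) :
    0 ≤ varV k ψ := by
  by_cases h : HasFiniteSecondMoments ψ
  · obtain ⟨T, hT, hle⟩ := exists_traceOn_ge_of_finrank hψ h hk hkn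
    refine le_trans ?_ (traceOn_le_varV h hT)
    exact_mod_cast nonneg_of_meanExcess_le (by omega) hψ h hle
  · simp [varV, h]

theorem varW_nonneg {n k : ℕ} {ψ : Fock n} (hψ : ‖ψ‖ = 1) (hk : 1 ≤ k) (hkn : k ≤ n) :
    0 ≤ varW k ψ := by
  by_cases h : HasFiniteSecondMoments ψ
  · obtain ⟨T, hT, hle⟩ := exists_traceOn_ge_of_modes hψ h hk hkn
    refine le_trans ?_ (traceOn_le_varW h hT)
    exact_mod_cast nonneg_of_meanExcess_le (by omega) hψ h hle
  · simp [varW, h]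

/-- `f` controls the distance to the coherent states. -/
def DominatesOverlap {n : ℕ} (f : Fock n → EReal) : Prop :=
  ∀ ψ : Fock n, ‖ψ‖ = 1 → ∃ α : Fin n → ℂ,
    ENNReal.ofReal (1 - ‖⟪coherent α, ψ⟫_ℂ‖ ^ 2) ≤ n * (f ψ).toENNReal

theorem dominatesOverlap_of_traceOn {n : ℕ} (hn : 1 ≤ n) (f : Fock n → EReal)
    (htop : ∀ ψ, ¬ HasFiniteSecondMoments ψ → f ψ = ⊤)
    (hle : ∀ ψ : Fock n, ‖ψ‖ = 1 → HasFiniteSecondMoments ψ →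
      ∃ t : ℝ, meanExcess ψ ≤ n * t ∧ (t : EReal) ≤ f ψ) : DominatesOverlap f := by
  intro ψ hψ
  by_cases h : HasFiniteSecondMoments ψ
  · obtain ⟨α, hα⟩ := exists_coherent_overlap hψ h
    obtain ⟨t, ht, htf⟩ := hle ψ hψ h
    refine ⟨α, ?_⟩
    calc ENNReal.ofReal (1 - ‖⟪coherent α, ψ⟫_ℂ‖ ^ 2) ≤ ENNReal.ofReal (n * t) :=
          ENNReal.ofReal_le_ofReal (hα.trans ht)
      _ = n * ENNReal.ofReal t := by
          rw [ENNReal.ofReal_mul (Nat.cast_nonneg _), ENNReal.ofReal_natCast]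
      _ ≤ n * (f ψ).toENNReal := by
          gcongr
          have := EReal.toENNReal_le_toENNReal htf
          simpa using this
  · refine ⟨0, ?_⟩
    rw [htop ψ h, EReal.toENNReal_top, ENNReal.mul_top (by exact_mod_cast (by omega : n ≠ 0))]
    exact le_top

theorem dominatesOverlap_varV {n k : ℕ} (hk : 1 ≤ k) (hkn : k ≤ 2 * n) :
    DominatesOverlap (varV k : Fock n → EReal) :=
  dominatesOverlap_of_traceOn (by omega) _ (fun ψ h => by simp [varV, h]) fun ψ hψ h => by
    obtain ⟨T, hT, hle⟩ := exists_traceOn_ge_of_finrank hψ h hk hkn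
    exact ⟨_, hle, traceOn_le_varV h hT⟩

theorem dominatesOverlap_varW {n k : ℕ} (hk : 1 ≤ k) (hkn : k ≤ n) :
    DominatesOverlap (varW k : Fock n → EReal) :=
  dominatesOverlap_of_traceOn (by omega) _ (fun ψ h => by simp [varW, h]) fun ψ hψ h => by
    obtain ⟨S, hS, hle⟩ := exists_traceOn_ge_of_modes hψ h hk hkn
    exact ⟨_, hle, traceOn_le_varW h hS⟩

/-! ### The trace distance of pure states -/

theorem proj_apply {n : ℕ} (ψ x : Fock n) : proj ψ x = ⟪ψ, x⟫_ℂ • ψ := by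
  simp [proj]

theorem proj_mul_self {n : ℕ} {ψ : Fock n} (hψ : ‖ψ‖ = 1) : proj ψ * proj ψ = proj ψ := by
  ext1 x
  rw [mul_apply_eq_comp, proj_apply, proj_apply, inner_smul_right,
    inner_self_eq_norm_sq_to_K, hψ]
  simp

theorem proj_mul_proj_mul_proj {n : ℕ} (ψ φ : Fock n) :
    proj ψ * proj φ * proj ψ = ((‖⟪φ, ψ⟫_ℂ‖ ^ 2 : ℝ) : ℂ) • proj ψ := by
  ext1 x
  rw [mul_apply_eq_comp, mul_apply_eq_comp, smul_apply,
    proj_apply, proj_apply, proj_apply, inner_smul_right, inner_smul_right, smul_smul]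
  congr 1
  rw [← Complex.normSq_eq_norm_sq, ← Complex.mul_conj, inner_conj_symm]
  ring

theorem proj_isSelfAdjoint {n : ℕ} (ψ : Fock n) : IsSelfAdjoint (proj ψ) := by
  rw [ContinuousLinearMap.isSelfAdjoint_iff']
  refine (ContinuousLinearMap.eq_adjoint_iff _ _).2 (fun x y => ?_) |>.symm
  rw [proj_apply, proj_apply, inner_smul_left, inner_smul_right, inner_conj_symm]
  ring

/-- For rank-one projections, `(P - Q)²` acts on the ranges of both `P` and `Q` as the scalar `1 -
|⟨φ|ψ⟩|²`. -/
theorem sq_mul_sq_proj_sub {n : ℕ} {ψ φ : Fock n} (hψ : ‖ψ‖ = 1) (hφ : ‖φ‖ = 1) :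
    ((proj ψ - proj φ) * (proj ψ - proj φ)) * ((proj ψ - proj φ) * (proj ψ - proj φ))
      = ((1 - ‖⟪φ, ψ⟫_ℂ‖ ^ 2 : ℝ) : ℂ) • ((proj ψ - proj φ) * (proj ψ - proj φ)) := by
  have hP := proj_mul_self hψ
  have hQ := proj_mul_self hφ
  have hPQP := proj_mul_proj_mul_proj ψ φ
  have hQPQ := proj_mul_proj_mul_proj φ ψ
  rw [norm_inner_symm] at hQPQ
  set P := proj ψ
  set Q := proj φ
  set t : ℂ := ((‖⟪φ, ψ⟫_ℂ‖ ^ 2 : ℝ) : ℂ) with ht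
  have h1 : (P - Q) * (P - Q) * P = (1 - t) • P := by
    have : (P - Q) * (P - Q) * P = P * P * P - Q * (P * P) - P * Q * P + Q * Q * P := by
      noncomm_ring
    rw [this, hP, hP, hQ, hPQP, sub_smul, one_smul]
    abel
  have h2 : (P - Q) * (P - Q) * Q = (1 - t) • Q := by
    have : (P - Q) * (P - Q) * Q = P * P * Q - Q * P * Q - P * (Q * Q) + Q * Q * Q := by
      noncomm_ring
    rw [this, hP, hQ, hQ, hQPQ, sub_smul, one_smul]
    abel
  have h3 : ((1 - ‖⟪φ, ψ⟫_ℂ‖ ^ 2 : ℝ) : ℂ) = 1 - t := by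
    rw [ht]
    push_cast
    rfl
  rw [h3, ← mul_assoc, mul_sub ((P - Q) * (P - Q)) P Q, h1, h2, ← smul_sub, smul_mul_assoc]

/-- The right side is positive and squares to `a²`, so it is the positive square root. For `c = 0`
the hypothesis forces `a² = 0`, consistent with `0⁻¹ = 0`. -/
theorem cfcAbs_eq_smul_mul_self {B : Type*} [CStarAlgebra B] [PartialOrder B] [StarOrderedRing B]
    {a : B} (ha : star a = a) {c : ℝ} (hc : 0 ≤ c)
    (h : (a * a) * (a * a) = ((c ^ 2 : ℝ) : ℂ) • (a * a)) :
    CFC.abs a = ((c⁻¹ : ℝ) : ℂ) • (a * a) := by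
  rw [CFC.abs, ha]
  refine CFC.sqrt_unique ?_ ?_
  · rw [smul_mul_smul_comm, h, smul_smul]
    by_cases h0 : c = 0
    · have h2 : star (a * a) * (a * a) = 0 := by
        rw [star_mul, ha, h, h0]
        simp
      rw [CStarRing.star_mul_self_eq_zero_iff] at h2
      rw [h2, smul_zero]
    · have : ((c⁻¹ : ℝ) : ℂ) * ((c⁻¹ : ℝ) : ℂ) * ((c ^ 2 : ℝ) : ℂ) = 1 := by
        have : (c : ℂ) ≠ 0 := by exact_mod_cast h0
        push_cast
        field_simp
      rw [this, one_smul]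
  · have h1 := star_mul_self_nonneg ((Real.sqrt c⁻¹ : ℂ) • a)
    have h2 : (Real.sqrt c⁻¹ : ℂ) * (Real.sqrt c⁻¹ : ℂ) = ((c⁻¹ : ℝ) : ℂ) := by
      rw [← Complex.ofReal_mul, Real.mul_self_sqrt (inv_nonneg.2 hc)]
    rwa [star_smul, ha, smul_mul_smul_comm, Complex.star_def, Complex.conj_ofReal, h2] at h1

theorem opAbs_proj_sub {n : ℕ} {ψ φ : Fock n} (hψ : ‖ψ‖ = 1) (hφ : ‖φ‖ = 1) {c : ℝ}
    (hc : 0 ≤ c) (hc2 : c ^ 2 = 1 - ‖⟪φ, ψ⟫_ℂ‖ ^ 2) :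
    opAbs (proj ψ - proj φ)
      = ((c⁻¹ : ℝ) : ℂ) • ((proj ψ - proj φ) * (proj ψ - proj φ)) :=
  cfcAbs_eq_smul_mul_self
    ((proj_isSelfAdjoint ψ).sub (proj_isSelfAdjoint φ)).star_eq hc
    (by rw [hc2]; exact sq_mul_sq_proj_sub hψ hφ)

theorem inner_numberState {n : ℕ} (m : Fin n → ℕ) (x : Fock n) :
    ⟪numberState m, x⟫_ℂ = x m := by
  rw [numberState, lp.inner_single_left]
  simp

theorem hasSum_inner_sq_proj_sub {n : ℕ} {ψ φ : Fock n} (hψ : ‖ψ‖ = 1) (hφ : ‖φ‖ = 1) :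
    HasSum (fun m : Fin n → ℕ => ⟪numberState m,
      ((proj ψ - proj φ) * (proj ψ - proj φ)) (numberState m)⟫_ℂ)
      (((2 * (1 - ‖⟪φ, ψ⟫_ℂ‖ ^ 2) : ℝ)) : ℂ) := by
  have hψψ : ⟪ψ, ψ⟫_ℂ = 1 := by
    rw [inner_self_eq_norm_sq_to_K, hψ]
    simp
  have hφφ : ⟪φ, φ⟫_ℂ = 1 := by
    rw [inner_self_eq_norm_sq_to_K, hφ]
    simp
  have h1 := lp.hasSum_inner (𝕜 := ℂ) ψ ψ
  have h2 := lp.hasSum_inner (𝕜 := ℂ) φ φ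
  have h3 := (lp.hasSum_inner (𝕜 := ℂ) φ ψ).mul_left ⟪ψ, φ⟫_ℂ
  have h4 := (lp.hasSum_inner (𝕜 := ℂ) ψ φ).mul_left ⟪φ, ψ⟫_ℂ
  have h := (h1.add h2).sub (h3.add h4)
  have hval : ⟪ψ, ψ⟫_ℂ + ⟪φ, φ⟫_ℂ - (⟪ψ, φ⟫_ℂ * ⟪φ, ψ⟫_ℂ + ⟪φ, ψ⟫_ℂ * ⟪ψ, φ⟫_ℂ)
      = (((2 * (1 - ‖⟪φ, ψ⟫_ℂ‖ ^ 2) : ℝ)) : ℂ) := by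
    have : ((‖⟪φ, ψ⟫_ℂ‖ ^ 2 : ℝ) : ℂ) = ⟪φ, ψ⟫_ℂ * ⟪ψ, φ⟫_ℂ := by
      rw [← Complex.normSq_eq_norm_sq, ← Complex.mul_conj, inner_conj_symm]
    rw [Complex.ofReal_mul, Complex.ofReal_sub, this, hψψ, hφφ]
    push_cast
    ring
  rw [← hval]
  refine (congrArg (fun f => HasSum f _) (funext fun m => ?_)).mpr h
  have hin : ∀ x : Fock n, ⟪x, numberState m⟫_ℂ = starRingEnd ℂ (x m) := by
    intro x
    rw [← inner_conj_symm, inner_numberState]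
  simp only [mul_apply_eq_comp, sub_apply, proj_apply,
    inner_sub_right, inner_smul_right, hin, inner_numberState, hψψ, hφφ, RCLike.inner_apply]
  ring

theorem traceDist_proj_sq {n : ℕ} {ψ φ : Fock n} (hψ : ‖ψ‖ = 1) (hφ : ‖φ‖ = 1) :
    traceDist (proj ψ) (proj φ) ^ 2 = ENNReal.ofReal (1 - ‖⟪φ, ψ⟫_ℂ‖ ^ 2) := by
  have hle : ‖⟪φ, ψ⟫_ℂ‖ ≤ 1 := by
    have := norm_inner_le_norm (𝕜 := ℂ) φ ψ
    rwa [hψ, hφ, one_mul] at this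
  have hd : 0 ≤ 1 - ‖⟪φ, ψ⟫_ℂ‖ ^ 2 := by nlinarith [norm_nonneg ⟪φ, ψ⟫_ℂ]
  obtain ⟨c, hc, hc2⟩ : ∃ c : ℝ, 0 ≤ c ∧ c ^ 2 = 1 - ‖⟪φ, ψ⟫_ℂ‖ ^ 2 :=
    ⟨_, Real.sqrt_nonneg _, Real.sq_sqrt hd⟩
  have hs := hasSum_inner_sq_proj_sub hψ hφ
  rw [← hc2] at hs ⊢
  have hs2 := Complex.hasSum_re hs
  rw [Complex.ofReal_re] at hs2
  have habs : ∀ m : Fin n → ℕ,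
      (⟪numberState m, opAbs (proj ψ - proj φ) (numberState m)⟫_ℂ).re
      = c⁻¹ * (⟪numberState m,
          ((proj ψ - proj φ) * (proj ψ - proj φ)) (numberState m)⟫_ℂ).re := by
    intro m
    rw [opAbs_proj_sub hψ hφ hc hc2, smul_apply, inner_smul_right,
      Complex.re_ofReal_mul]
  have hnn : ∀ m : Fin n → ℕ,
      0 ≤ (⟪numberState m, opAbs (proj ψ - proj φ) (numberState m)⟫_ℂ).re := by
    intro m
    have : (0 : Op n) ≤ opAbs (proj ψ - proj φ) := CFC.abs_nonneg _
    rw [ContinuousLinearMap.nonneg_iff_isPositive] at this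
    exact this.re_inner_nonneg_right _
  have hs3 : HasSum (fun m : Fin n → ℕ =>
      (⟪numberState m, opAbs (proj ψ - proj φ) (numberState m)⟫_ℂ).re) (2 * c) := by
    have := hs2.mul_left c⁻¹
    simp_rw [← habs] at this
    have hcc : c⁻¹ * (2 * c ^ 2) = 2 * c := by
      by_cases h0 : c = 0
      · simp [h0]
      · field_simp
    rwa [hcc] at this
  have htr : traceAbs (proj ψ - proj φ) = ENNReal.ofReal (2 * c) := by
    rw [traceAbs, ← ENNReal.ofReal_tsum_of_nonneg hnn hs3.summable, hs3.tsum_eq]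
  have h2 : (2 : ℝ≥0∞) = ENNReal.ofReal 2 := by simp
  rw [traceDist, htr, h2, ← ENNReal.ofReal_div_of_pos (by norm_num), ENNReal.ofReal_pow hc]
  congr 2
  ring

theorem exists_coherent_traceDist_sq_le {n : ℕ} (ψ : PureState n) :
    ∃ α : Fin n → ℂ, ((traceDist (proj (ψ : Fock n)) (proj (coherent α)) ^ 2 : ℝ≥0∞) : EReal)
      ≤ (n : EReal) * varV 1 (ψ : Fock n) := by
  have hψ : ‖(ψ : Fock n)‖ = 1 := by simp
  rcases Nat.eq_zero_or_pos n with rfl | hn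
  -- Without modes `varV 1` is a supremum over no subspaces, that is `⊥`, but `0 * ⊥ = 0` in
  -- `EReal`; the left side vanishes because the trace of the excess is an empty sum.
  · have h : HasFiniteSecondMoments (ψ : Fock 0) := fun s => s.1.elim0
    obtain ⟨α, hα⟩ := exists_coherent_overlap hψ h
    refine ⟨α, ?_⟩
    rw [traceDist_proj_sq hψ (norm_coherent α), ENNReal.ofReal_of_nonpos (by simpa using hα)]
    simp
  · obtain ⟨α, hα⟩ := dominatesOverlap_varV (n := n) le_rfl (by omega) (ψ : Fock n) hψ
    refine ⟨α, ?_⟩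
    rw [traceDist_proj_sq hψ (norm_coherent α)]
    have h0 := varV_nonneg (n := n) (k := 1) hψ le_rfl (by omega)
    calc ((ENNReal.ofReal (1 - ‖⟪coherent α, (ψ : Fock n)⟫_ℂ‖ ^ 2) : ℝ≥0∞) : EReal)
        ≤ ((n * (varV 1 (ψ : Fock n)).toENNReal : ℝ≥0∞) : EReal) := by exact_mod_cast hα
      _ = (n : EReal) * varV 1 (ψ : Fock n) := by
          rw [EReal.coe_ennreal_mul, EReal.coe_toENNReal h0]
          rfl

/-! ### Continuity of coherent states -/

theorem inner_coherentAmpOne_hasSum (α β : ℂ) :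
    HasSum (fun k => starRingEnd ℂ (coherentAmpOne α k) * coherentAmpOne β k)
      (Complex.exp (-‖α‖ ^ 2 / 2 - ‖β‖ ^ 2 / 2 + starRingEnd ℂ α * β)) := by
  have h := (NormedSpace.expSeries_div_hasSum_exp (𝔸 := ℂ) (starRingEnd ℂ α * β)).mul_left
    (Complex.exp (-‖α‖ ^ 2 / 2 - ‖β‖ ^ 2 / 2))
  rw [← Complex.exp_eq_exp_ℂ, ← Complex.exp_add] at h
  refine (congrArg (fun f => HasSum f _) (funext fun k => ?_)).mpr h
  have hs : (Real.sqrt k.factorial : ℂ) * (Real.sqrt k.factorial : ℂ) = k.factorial := by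
    rw [← Complex.ofReal_mul, Real.mul_self_sqrt (Nat.cast_nonneg _)]
    simp
  have he : Complex.exp (-(‖α‖ : ℂ) ^ 2 / 2 - (‖β‖ : ℂ) ^ 2 / 2)
      = Complex.exp (-(‖α‖ : ℂ) ^ 2 / 2) * Complex.exp (-(‖β‖ : ℂ) ^ 2 / 2) := by
    rw [← Complex.exp_add]
    congr 1
    ring
  rw [coherentAmpOne, coherentAmpOne, map_div₀, map_mul, Complex.conj_ofReal, Complex.conj_ofReal,
    map_pow, he, ← hs, mul_pow]
  push_cast
  rw [div_mul_div_comm, mul_div_assoc']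
  congr 1
  ring

theorem inner_coherent {n : ℕ} (α β : Fin n → ℂ) :
    ⟪coherent α, coherent β⟫_ℂ
      = ∏ i, Complex.exp (-‖α i‖ ^ 2 / 2 - ‖β i‖ ^ 2 / 2 + starRingEnd ℂ (α i) * β i) := by
  have h := hasSum_prod_apply
    (fun i k => starRingEnd ℂ (coherentAmpOne (α i) k) * coherentAmpOne (β i) k) _
    (fun i => (summable_conj_coherentAmpOne_mul (α i) (u := coherentAmpOne (β i))
      (by simp [sqNorm_coherentAmpOne])).norm)
    (fun i => inner_coherentAmpOne_hasSum (α i) (β i))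
  rw [← h.tsum_eq, lp.inner_eq_tsum]
  refine tsum_congr fun m => ?_
  rw [RCLike.inner_apply]
  change coherentAmp β m * starRingEnd ℂ (coherentAmp α m) = _
  rw [coherentAmp_eq_prod, coherentAmp_eq_prod, map_prod, ← Finset.prod_mul_distrib]
  exact Finset.prod_congr rfl fun i _ => mul_comm _ _

theorem continuous_coherent {n : ℕ} : Continuous (coherent : (Fin n → ℂ) → Fock n) := by
  rw [continuous_iff_continuousAt]
  intro α
  rw [ContinuousAt, tendsto_iff_norm_sub_tendsto_zero]
  have hsq : ∀ β : Fin n → ℂ, ‖coherent β - coherent α‖ ^ 2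
      = 2 - 2 * (⟪coherent β, coherent α⟫_ℂ).re := by
    intro β
    rw [@norm_sub_sq ℂ, norm_coherent, norm_coherent]
    simp only [RCLike.re_to_complex]
    ring
  have hc : Continuous fun β : Fin n → ℂ => 2 - 2 * (⟪coherent β, coherent α⟫_ℂ).re := by
    simp_rw [inner_coherent]
    fun_prop
  have h1 := hc.tendsto α
  have h0 : 2 - 2 * (⟪coherent α, coherent α⟫_ℂ).re = 0 := by
    rw [← hsq, sub_self, norm_zero]
    norm_num
  rw [h0] at h1
  simp_rw [← hsq] at h1
  have h2 := h1.sqrt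
  simpa using h2

/-- The kernel `⟨x|ψ⟩⟨ψ|y⟩`. -/
def kernel {n : ℕ} (x y ψ : Fock n) : ℂ := ⟪x, ψ⟫_ℂ * ⟪ψ, y⟫_ℂ

theorem continuous_kernel {n : ℕ} (x y : Fock n) : Continuous (kernel x y) := by
  unfold kernel
  fun_prop

theorem norm_kernel_le {n : ℕ} (x y : Fock n) {ψ : Fock n} (hψ : ‖ψ‖ = 1) :
    ‖kernel x y ψ‖ ≤ ‖x‖ * ‖y‖ := by
  rw [kernel, norm_mul]
  have h1 := norm_inner_le_norm (𝕜 := ℂ) x ψ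
  have h2 := norm_inner_le_norm (𝕜 := ℂ) ψ y
  rw [hψ] at h1 h2
  rw [mul_one] at h1
  rw [one_mul] at h2
  gcongr

/-- Write `ψ = r + sφ` with `r` orthogonal to `φ` and `e = ‖r‖ = √(1 - |s|²)`. The difference splits
into three terms, two linear in `r` and one with factor `e² ≤ e`; hence the constant 3. -/
theorem norm_kernel_sub_le {n : ℕ} (x y : Fock n) {ψ φ : Fock n} (hψ : ‖ψ‖ = 1) (hφ : ‖φ‖ = 1) :
    ‖kernel x y ψ - kernel x y φ‖ ≤ 3 * Real.sqrt (1 - ‖⟪φ, ψ⟫_ℂ‖ ^ 2) * (‖x‖ * ‖y‖) := by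
  set s := ⟪φ, ψ⟫_ℂ with hs
  set r := ψ - s • φ with hr
  have hs1 : ‖s‖ ≤ 1 := by
    have := norm_inner_le_norm (𝕜 := ℂ) φ ψ
    rwa [hψ, hφ, one_mul] at this
  have hd : 0 ≤ 1 - ‖s‖ ^ 2 := by nlinarith [norm_nonneg s]
  have hrn : ‖r‖ = Real.sqrt (1 - ‖s‖ ^ 2) := by
    rw [eq_comm, Real.sqrt_eq_iff_mul_self_eq hd (norm_nonneg _), ← sq, hr, @norm_sub_sq ℂ,
      inner_smul_right, norm_smul, hψ, hφ, ← inner_conj_symm ψ φ, ← hs, Complex.mul_conj,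
      Complex.normSq_eq_norm_sq]
    simp only [RCLike.re_to_complex, Complex.ofReal_re]
    ring
  set e := Real.sqrt (1 - ‖s‖ ^ 2) with he
  have he0 : 0 ≤ e := Real.sqrt_nonneg _
  have he2 : e * e = 1 - ‖s‖ ^ 2 := Real.mul_self_sqrt hd
  have he1 : e ≤ 1 := by nlinarith [norm_nonneg s]
  have hψr : ψ = r + s • φ := by rw [hr]; abel
  have hdec : kernel x y ψ - kernel x y φ
      = ⟪x, r⟫_ℂ * ⟪ψ, y⟫_ℂ + s * ⟪x, φ⟫_ℂ * ⟪r, y⟫_ℂ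
        - ((e * e : ℝ) : ℂ) * kernel x y φ := by
    have h1 : ⟪x, ψ⟫_ℂ = ⟪x, r⟫_ℂ + s * ⟪x, φ⟫_ℂ := by
      conv_lhs => rw [hψr]
      rw [inner_add_right, inner_smul_right]
    have h2 : ⟪ψ, y⟫_ℂ = ⟪r, y⟫_ℂ + starRingEnd ℂ s * ⟪φ, y⟫_ℂ := by
      conv_lhs => rw [hψr]
      rw [inner_add_left, inner_smul_left]
    have h3 : ((e * e : ℝ) : ℂ) = 1 - s * starRingEnd ℂ s := by
      rw [he2, Complex.mul_conj, Complex.normSq_eq_norm_sq]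
      push_cast
      rfl
    rw [kernel, kernel, h1, h3]
    linear_combination (s * ⟪x, φ⟫_ℂ) * h2
  have hb : ∀ u v : Fock n, ‖⟪u, v⟫_ℂ‖ ≤ ‖u‖ * ‖v‖ := fun u v => norm_inner_le_norm u v
  have b1 : ‖⟪x, r⟫_ℂ * ⟪ψ, y⟫_ℂ‖ ≤ e * (‖x‖ * ‖y‖) := by
    rw [norm_mul]
    calc _ ≤ (‖x‖ * ‖r‖) * (‖ψ‖ * ‖y‖) := by gcongr <;> exact hb _ _
      _ = _ := by rw [hrn, hψ]; ring
  have b2 : ‖s * ⟪x, φ⟫_ℂ * ⟪r, y⟫_ℂ‖ ≤ e * (‖x‖ * ‖y‖) := by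
    rw [norm_mul, norm_mul]
    calc _ ≤ 1 * (‖x‖ * ‖φ‖) * (‖r‖ * ‖y‖) := by gcongr <;> exact hb _ _
      _ = _ := by rw [hrn, hφ]; ring
  have b3 : ‖((e * e : ℝ) : ℂ) * kernel x y φ‖ ≤ e * (‖x‖ * ‖y‖) := by
    rw [norm_mul, Complex.norm_real, Real.norm_of_nonneg (mul_nonneg he0 he0)]
    have := norm_kernel_le x y hφ
    gcongr
    nlinarith
  rw [hdec]
  refine (norm_sub_le _ _).trans ?_
  refine (add_le_add_left (norm_add_le _ _) _).trans ?_
  linarith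

/-! ### Classical states have vanishing convex roofs -/

/-- The coherent state as a unit vector. -/
def coherentPure {n : ℕ} (α : Fin n → ℂ) : PureState n :=
  ⟨coherent α, by simp [norm_coherent]⟩

theorem continuous_coherentPure {n : ℕ} :
    Continuous (coherentPure : (Fin n → ℂ) → PureState n) :=
  continuous_coherent.subtype_mk _

theorem convexRoof_eq_zero_of_isClassical {n : ℕ} {f : Fock n → EReal}
    (hf : ∀ α : Fin n → ℂ, f (coherent α) ≤ 0) {ρ : Op n} (h : IsClassical ρ) :
    convexRoof f ρ = 0 := by
  obtain ⟨P, hP, hρ⟩ := h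
  have hm : Measurable (coherentPure : (Fin n → ℂ) → PureState n) :=
    continuous_coherentPure.measurable
  have hdec : IsDecomposition ρ (P.map coherentPure) := by
    refine ⟨Measure.isProbabilityMeasure_map hm.aemeasurable, fun x y => ?_⟩
    rw [hρ, integral_map hm.aemeasurable]
    · rfl
    · exact ((continuous_kernel x y).comp continuous_subtype_val).aestronglyMeasurable
  -- For the lower integral this direction of the change of variables needs no measurability of `f`.
  refine le_antisymm ((iInf₂_le _ hdec).trans ((lintegral_map_le _ _).trans ?_)) zero_le
  have : ∀ α : Fin n → ℂ, (f (coherentPure α : Fock n)).toENNReal = 0 :=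
    fun α => EReal.toENNReal_of_nonpos (hf α)
  simp [this]

/-! ### Approximation by classical states -/

/-- The weak distance of `ρ` from the mixture of coherent states with the law `P`. -/
def IsApproxClassical {n : ℕ} (ρ : Op n) (ε : ℝ) (P : Measure (Fin n → ℂ)) : Prop :=
  ∀ x y : Fock n, ‖⟪x, ρ y⟫_ℂ - ∫ α, kernel x y (coherent α) ∂P‖ ≤ ε * (‖x‖ * ‖y‖)

/-- A closest coherent state need not depend measurably on `ψ`. By continuity the infimum of the
infidelity is already reached along a dense sequence of amplitudes, and the first term within `ε` of
it is a measurable choice. Nothing is asked of `f` beyond the domination. -/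
theorem exists_measurable_coherent {n : ℕ} {ε : ℝ≥0∞} (hε : ε ≠ 0) {f : Fock n → EReal}
    (hf : DominatesOverlap f) :
    ∃ A : PureState n → Fin n → ℂ, Measurable A ∧
      Measurable (fun ψ : PureState n =>
        ENNReal.ofReal (1 - ‖⟪coherent (A ψ), (ψ : Fock n)⟫_ℂ‖ ^ 2)) ∧
      ∀ ψ : PureState n, ENNReal.ofReal (1 - ‖⟪coherent (A ψ), (ψ : Fock n)⟫_ℂ‖ ^ 2)
        ≤ n * (f (ψ : Fock n)).toENNReal + ε := by
  classical
  let a : ℕ → Fin n → ℂ := TopologicalSpace.denseSeq _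
  let h : ℕ → PureState n → ℝ≥0∞ := fun k ψ =>
    ENNReal.ofReal (1 - ‖⟪coherent (a k), (ψ : Fock n)⟫_ℂ‖ ^ 2)
  have hm : ∀ k, Measurable (h k) := by
    intro k
    exact (ENNReal.continuous_ofReal.comp (by fun_prop)).measurable
  let g : PureState n → ℝ≥0∞ := fun ψ => ⨅ k, h k ψ
  have hg : Measurable g := Measurable.iInf hm
  have hgle : ∀ (ψ : PureState n) (α : Fin n → ℂ),
      g ψ ≤ ENNReal.ofReal (1 - ‖⟪coherent α, (ψ : Fock n)⟫_ℂ‖ ^ 2) := by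
    intro ψ α
    have hcl : IsClosed {α : Fin n → ℂ |
        g ψ ≤ ENNReal.ofReal (1 - ‖⟪coherent α, (ψ : Fock n)⟫_ℂ‖ ^ 2)} := by
      have := continuous_coherent (n := n)
      exact isClosed_le continuous_const (ENNReal.continuous_ofReal.comp (by fun_prop))
    have hd : Dense (Set.range a) := TopologicalSpace.denseRange_denseSeq _
    refine closure_minimal ?_ hcl (hd α)
    rintro _ ⟨k, rfl⟩
    exact iInf_le (fun k => h k ψ) k
  have hfin : ∀ ψ, g ψ ≠ ⊤ := fun ψ => ne_top_of_le_ne_top ENNReal.ofReal_ne_top (hgle ψ 0)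
  have hex : ∀ ψ, ∃ k, h k ψ < g ψ + ε := by
    intro ψ
    exact iInf_lt_iff.1 (ENNReal.lt_add_right (hfin ψ) hε)
  have hset : ∀ k, MeasurableSet {ψ | h k ψ < g ψ + ε} :=
    fun k => measurableSet_lt (hm k) (hg.add_const ε)
  refine ⟨fun ψ => a (Nat.find (hex ψ)),
    (measurable_from_top (f := a)).comp (measurable_find hex hset),
    Measurable.find hm hset hex, fun ψ => ?_⟩
  obtain ⟨α, hα⟩ := hf (ψ : Fock n) (by simp)
  exact (Nat.find_spec (hex ψ)).le.trans (add_le_add ((hgle ψ α).trans hα) le_rfl)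

theorem exists_isApproxClassical {n : ℕ} {f : Fock n → EReal} (hf : DominatesOverlap f)
    {ρ : Op n} (hρ : convexRoof f ρ = 0) {ε : ℝ} (hε : 0 < ε) :
    ∃ P : Measure (Fin n → ℂ), IsProbabilityMeasure P ∧ IsApproxClassical ρ ε P := by
  -- With `δ = η² / (n + 1)` the mean infidelity is at most `nδ + δ = η²`. As `√d ≤ η + d/η`, the
  -- kernels then differ on average by at most `3(η + η) = ε`, up to `‖x‖ ‖y‖`.
  set η : ℝ := ε / 6 with hη
  have hη0 : 0 < η := by positivity
  set δ : ℝ := η ^ 2 / (n + 1) with hδ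
  have hδ0 : 0 < δ := by positivity
  have hlt : convexRoof f ρ < ENNReal.ofReal δ := by
    rw [hρ]
    exact ENNReal.ofReal_pos.2 hδ0
  obtain ⟨μ, hlt⟩ := iInf_lt_iff.1 hlt
  obtain ⟨hμ, hlt⟩ := iInf_lt_iff.1 hlt
  have := hμ.1
  obtain ⟨A, hA, hmeas, hle⟩ :=
    exists_measurable_coherent (ENNReal.ofReal_pos.2 hδ0).ne' hf
  set d : PureState n → ℝ := fun ψ => 1 - ‖⟪coherent (A ψ), (ψ : Fock n)⟫_ℂ‖ ^ 2 with hd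
  have hd0 : ∀ ψ, 0 ≤ d ψ := by
    intro ψ
    have := norm_inner_le_norm (𝕜 := ℂ) (coherent (A ψ)) (ψ : Fock n)
    rw [norm_coherent, norm_eq_of_mem_sphere, one_mul] at this
    simp only [hd]
    nlinarith [norm_nonneg ⟪coherent (A ψ), (ψ : Fock n)⟫_ℂ]
  have hdm : Measurable d := by
    have := hmeas.ennreal_toReal
    refine (congrArg Measurable (funext fun ψ => ?_)).mp this
    exact ENNReal.toReal_ofReal (hd0 ψ)
  have hlint : ∫⁻ ψ, ENNReal.ofReal (d ψ) ∂μ ≤ ENNReal.ofReal (η ^ 2) := by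
    calc ∫⁻ ψ, ENNReal.ofReal (d ψ) ∂μ
        ≤ ∫⁻ ψ : PureState n, (n * (f (ψ : Fock n)).toENNReal + ENNReal.ofReal δ) ∂μ :=
          lintegral_mono hle
      _ = n * ∫⁻ ψ : PureState n, (f (ψ : Fock n)).toENNReal ∂μ + ENNReal.ofReal δ := by
          rw [lintegral_add_right _ measurable_const, lintegral_const_mul' _ _ (by simp)]
          simp
      _ ≤ n * ENNReal.ofReal δ + ENNReal.ofReal δ := by gcongr
      _ = ENNReal.ofReal (η ^ 2) := by
          rw [← ENNReal.ofReal_natCast, ← ENNReal.ofReal_mul (Nat.cast_nonneg _),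
            ← ENNReal.ofReal_add (by positivity) hδ0.le]
          congr 1
          rw [hδ]
          field_simp
  have hd1 : ∀ ψ, d ψ ≤ 1 := fun ψ => sub_le_self _ (by positivity)
  have hdi : Integrable d μ := by
    refine Integrable.of_bound hdm.aestronglyMeasurable 1 (Filter.Eventually.of_forall fun ψ => ?_)
    rw [Real.norm_of_nonneg (hd0 ψ)]
    exact hd1 ψ
  have hint : ∫ ψ, d ψ ∂μ ≤ η ^ 2 := by
    rw [integral_eq_lintegral_of_nonneg_ae (Filter.Eventually.of_forall hd0)
      hdm.aestronglyMeasurable]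
    exact ENNReal.toReal_le_of_le_ofReal (by positivity) hlint
  refine ⟨μ.map A, Measure.isProbabilityMeasure_map hA.aemeasurable, fun x y => ?_⟩
  have hcont : Continuous fun α : Fin n → ℂ => kernel x y (coherent α) :=
    (continuous_kernel x y).comp continuous_coherent
  rw [hμ.2 x y, integral_map hA.aemeasurable hcont.aestronglyMeasurable]
  have hi1 : Integrable (fun ψ : PureState n => kernel x y (ψ : Fock n)) μ :=
    Integrable.of_bound
      ((continuous_kernel x y).comp continuous_subtype_val).aestronglyMeasurable (‖x‖ * ‖y‖)
      (Filter.Eventually.of_forall fun ψ => norm_kernel_le x y (by simp))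
  have hi2 : Integrable (fun ψ : PureState n => kernel x y (coherent (A ψ))) μ :=
    Integrable.of_bound (hcont.measurable.comp hA).aestronglyMeasurable (‖x‖ * ‖y‖)
      (Filter.Eventually.of_forall fun ψ => norm_kernel_le x y (norm_coherent _))
  change ‖∫ ψ : PureState n, kernel x y (ψ : Fock n) ∂μ - _‖ ≤ _
  rw [← integral_sub hi1 hi2]
  have hb : ∀ ψ : PureState n, ‖kernel x y (ψ : Fock n) - kernel x y (coherent (A ψ))‖
      ≤ 3 * (η + η⁻¹ * d ψ) * (‖x‖ * ‖y‖) := by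
    intro ψ
    refine (norm_kernel_sub_le x y (by simp) (norm_coherent (A ψ))).trans ?_
    have hs : Real.sqrt (d ψ) ≤ η + η⁻¹ * d ψ := by
      have h1 := Real.mul_self_sqrt (hd0 ψ)
      have h2 := Real.sqrt_nonneg (d ψ)
      rw [← mul_le_mul_iff_right₀ hη0]
      have h3 : η * (η + η⁻¹ * d ψ) = η * η + d ψ := by field_simp
      rw [h3]
      nlinarith [sq_nonneg (η - Real.sqrt (d ψ)), mul_nonneg hη0.le h2]
    gcongr
  have hi3 : Integrable (fun ψ => 3 * (η + η⁻¹ * d ψ) * (‖x‖ * ‖y‖)) μ :=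
    (((integrable_const η).add (hdi.const_mul η⁻¹)).const_mul 3).mul_const _
  refine (norm_integral_le_of_norm_le hi3 (Filter.Eventually.of_forall hb)).trans ?_
  have hval : ∫ ψ, 3 * (η + η⁻¹ * d ψ) * (‖x‖ * ‖y‖) ∂μ
      = 3 * (η + η⁻¹ * ∫ ψ, d ψ ∂μ) * (‖x‖ * ‖y‖) := by
    rw [integral_mul_const, integral_const_mul,
      integral_add (integrable_const η) (hdi.const_mul η⁻¹), integral_const_mul]
    simp
  rw [hval]
  have hfin : 3 * (η + η⁻¹ * ∫ ψ, d ψ ∂μ) ≤ ε := by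
    have : η⁻¹ * ∫ ψ, d ψ ∂μ ≤ η⁻¹ * η ^ 2 := by gcongr
    have h2 : η⁻¹ * η ^ 2 = η := by field_simp
    have h3 : ε = 6 * η := by rw [hη]; ring
    linarith
  gcongr

/-! ### Limits of classical states -/

open Filter Topology in
theorem tendsto_norm_coherentAmpOne_sq (k : ℕ) :
    Tendsto (fun α : ℂ => ‖coherentAmpOne α k‖ ^ 2) (cocompact ℂ) (𝓝 0) := by
  have h1 : Tendsto (fun α : ℂ => ‖α‖ ^ 2) (cocompact ℂ) atTop :=
    (tendsto_pow_atTop (by norm_num)).comp tendsto_norm_cocompact_atTop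
  have h2 := ((Real.tendsto_pow_mul_exp_neg_atTop_nhds_zero k).comp h1).mul_const
    ((k.factorial : ℝ)⁻¹)
  rw [zero_mul] at h2
  refine h2.congr fun α => ?_
  rw [coherentAmpOne, norm_div, norm_mul, norm_pow, Complex.norm_real, Complex.norm_real, div_pow,
    mul_pow, Real.norm_of_nonneg (Real.exp_pos _).le, Real.norm_of_nonneg (Real.sqrt_nonneg _),
    Real.sq_sqrt (Nat.cast_nonneg _), ← Real.exp_nat_mul]
  have h3 : ((2 : ℕ) : ℝ) * (-‖α‖ ^ 2 / 2) = -‖α‖ ^ 2 := by push_cast; ring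
  rw [h3, Function.comp_apply]
  ring

theorem norm_coherentAmpOne_sq_le_one (α : ℂ) (k : ℕ) : ‖coherentAmpOne α k‖ ^ 2 ≤ 1 :=
  le_hasSum (hasSum_norm_coherentAmpOne_sq α) k fun _ _ => by positivity

theorem sum_norm_coherent_sq_le_one {n : ℕ} (F : Finset (Fin n → ℕ)) (α : Fin n → ℂ) :
    ∑ m ∈ F, ‖coherent α m‖ ^ 2 ≤ 1 := by
  have h := lp.hasSum_norm (p := 2) (by simp) (coherent α)
  have h3 : (2 : ℝ≥0∞).toReal = ((2 : ℕ) : ℝ) := by simp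
  simp_rw [h3, Real.rpow_natCast, norm_coherent, one_pow] at h
  exact sum_le_hasSum F (fun _ _ => by positivity) h

-- Going to infinity in `ℂⁿ` means that some coordinate does; its Gaussian factor tends to 0 and the
-- other factors are at most 1.
open Filter Topology in
theorem tendsto_norm_coherent_sq {n : ℕ} (m : Fin n → ℕ) :
    Tendsto (fun α : Fin n → ℂ => ‖coherent α m‖ ^ 2) (cocompact (Fin n → ℂ)) (𝓝 0) := by
  rw [← coprodᵢ_cocompact, Filter.coprodᵢ, tendsto_iSup]
  intro i
  refine squeeze_zero (g := fun α : Fin n → ℂ => ‖coherentAmpOne (α i) (m i)‖ ^ 2)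
    (fun _ => by positivity) (fun α => ?_)
    ((tendsto_norm_coherentAmpOne_sq (m i)).comp tendsto_comap)
  change ‖coherentAmp α m‖ ^ 2 ≤ _
  rw [coherentAmp_eq_prod, norm_prod, ← Finset.prod_pow,
    ← Finset.mul_prod_erase _ _ (Finset.mem_univ i)]
  exact mul_le_of_le_one_right (by positivity)
    (Finset.prod_le_one (fun _ _ => by positivity) fun j _ => norm_coherentAmpOne_sq_le_one _ _)

theorem norm_numberState {n : ℕ} (m : Fin n → ℕ) : ‖numberState m‖ = 1 := by
  rw [numberState, lp.norm_single (by simp)]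
  simp

theorem kernel_numberState {n : ℕ} (m : Fin n → ℕ) (ψ : Fock n) :
    kernel (numberState m) (numberState m) ψ = ((‖ψ m‖ ^ 2 : ℝ) : ℂ) := by
  rw [kernel, ← inner_conj_symm ψ, inner_numberState, Complex.mul_conj, Complex.normSq_eq_norm_sq]

theorem continuous_norm_coherent_sq {n : ℕ} (m : Fin n → ℕ) :
    Continuous fun α : Fin n → ℂ => ‖coherent α m‖ ^ 2 := by
  have := continuous_coherent (n := n)
  simp_rw [← inner_numberState]
  fun_prop

theorem IsApproxClassical.re_sub_le_integral {n : ℕ} {ρ : Op n} {ε : ℝ}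
    {P : Measure (Fin n → ℂ)} (h : IsApproxClassical ρ ε P) (m : Fin n → ℕ) :
    (⟪numberState m, ρ (numberState m)⟫_ℂ).re - ε ≤ ∫ α, ‖coherent α m‖ ^ 2 ∂P := by
  have h1 := h (numberState m) (numberState m)
  simp_rw [kernel_numberState] at h1
  rw [integral_complex_ofReal, norm_numberState, mul_one, mul_one] at h1
  have h2 := (Complex.re_le_norm _).trans h1
  rw [Complex.sub_re, Complex.ofReal_re] at h2
  linarith

/-- A mixture of coherent states which approximates `ρ` puts little mass on amplitudes whose
coherent states nearly vanish on number states carrying most of `ρ`. -/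
theorem IsApproxClassical.measureReal_le {n : ℕ} {ρ : Op n} {ε e r : ℝ}
    {P : Measure (Fin n → ℂ)} [IsProbabilityMeasure P] (h : IsApproxClassical ρ ε P)
    (he : 0 ≤ e) {F : Finset (Fin n → ℕ)}
    (hF : 1 - e ≤ ∑ m ∈ F, (⟪numberState m, ρ (numberState m)⟫_ℂ).re)
    (hr : ∀ α : Fin n → ℂ, r < ‖α‖ → ∑ m ∈ F, ‖coherent α m‖ ^ 2 ≤ e) :
    P.real {α | r < ‖α‖} ≤ 2 * e + F.card * ε := by
  have hms : MeasurableSet {α : Fin n → ℂ | r < ‖α‖} :=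
    measurableSet_lt measurable_const measurable_norm
  have hi : ∀ m : Fin n → ℕ, Integrable (fun α => ‖coherent α m‖ ^ 2) P := by
    intro m
    refine Integrable.of_bound (continuous_norm_coherent_sq m).aestronglyMeasurable 1
      (Filter.Eventually.of_forall fun α => ?_)
    rw [Real.norm_of_nonneg (by positivity)]
    simpa using sum_norm_coherent_sq_le_one {m} α
  have hlow : 1 - e - F.card * ε ≤ ∫ α, ∑ m ∈ F, ‖coherent α m‖ ^ 2 ∂P := by
    rw [integral_finsetSum _ fun m _ => hi m]
    have := Finset.sum_le_sum fun m (_ : m ∈ F) => h.re_sub_le_integral m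
    rw [Finset.sum_sub_distrib, Finset.sum_const, nsmul_eq_mul] at this
    linarith
  have hup : ∫ α, ∑ m ∈ F, ‖coherent α m‖ ^ 2 ∂P
      ≤ ∫ α, (1 - {α : Fin n → ℂ | r < ‖α‖}.indicator (fun _ => 1 - e) α) ∂P := by
    refine integral_mono (integrable_finsetSum _ fun m _ => hi m)
      ((integrable_const _).sub ((integrable_const _).indicator hms)) fun α => ?_
    by_cases hα : r < ‖α‖
    · simpa [Set.indicator, hα] using hr α hα
    · simpa [Set.indicator, hα] using sum_norm_coherent_sq_le_one F α
  rw [integral_sub (integrable_const _) ((integrable_const _).indicator hms),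
    integral_indicator_const _ hms] at hup
  simp only [integral_const, probReal_univ, smul_eq_mul, mul_one] at hup
  have hp : P.real {α : Fin n → ℂ | r < ‖α‖} ≤ 1 := measureReal_le_one
  -- With `p` the mass in question, the bounds give `(1 - e) p ≤ e + |F| ε`; the second `e` comes
  -- from `e p ≤ e`.
  nlinarith

-- Trace one yields a finite set `F` of number states carrying more than `1 - e` of `ρ`, on which
-- coherent states of large amplitude are negligible. The escaping mass is at most `2e + |F| ε_j`,
-- eventually below `3e`; a bound on the limsup is enough for a sequence.
open Filter Topology in
theorem isTightMeasureSet_range_of_isApproxClassical {n : ℕ} {ρ : Op n}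
    (hρ : IsDensityOperator ρ) {ε : ℕ → ℝ} (hε : Tendsto ε atTop (𝓝 0))
    {P : ℕ → Measure (Fin n → ℂ)} [∀ j, IsProbabilityMeasure (P j)]
    (hP : ∀ j, IsApproxClassical ρ (ε j) (P j)) : IsTightMeasureSet (Set.range P) := by
  refine isTightMeasureSet_range_of_tendsto_limsup_measure_norm_gt ?_
  rw [ENNReal.tendsto_atTop_zero]
  intro δ hδ
  obtain ⟨e, he, heδ⟩ : ∃ e : ℝ, 0 < e ∧ ENNReal.ofReal (3 * e) ≤ δ := by
    obtain ⟨t, ht, htδ⟩ := ENNReal.lt_iff_exists_nnreal_btwn.1 hδ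
    refine ⟨t / 3, div_pos (by exact_mod_cast ht) (by norm_num), ?_⟩
    rw [mul_div_cancel₀ _ (by norm_num), ENNReal.ofReal_coe_nnreal]
    exact htδ.le
  have hsum := Complex.hasSum_re hρ.2
  rw [Complex.one_re] at hsum
  obtain ⟨F, hF⟩ := (hsum.eventually (lt_mem_nhds (sub_lt_self 1 he))).exists
  have hlim : Tendsto (fun α : Fin n → ℂ => ∑ m ∈ F, ‖coherent α m‖ ^ 2)
      (cocompact (Fin n → ℂ)) (𝓝 0) := by
    simpa using tendsto_finsetSum F fun m _ => tendsto_norm_coherent_sq m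
  have hev := hlim.eventually (gt_mem_nhds he)
  rw [← Metric.cobounded_eq_cocompact, ← comap_norm_atTop, eventually_comap,
    eventually_atTop] at hev
  obtain ⟨R, hR⟩ := hev
  refine ⟨R, fun r hr => (limsup_le_of_le (h := ?_)).trans heδ⟩
  have hεF : Tendsto (fun j => F.card * ε j) atTop (𝓝 0) := by
    simpa using hε.const_mul (F.card : ℝ)
  filter_upwards [hεF.eventually (gt_mem_nhds he)] with j hj
  have h1 := (hP j).measureReal_le he.le hF.le (r := r)
    fun α hα => (hR ‖α‖ (hr.trans hα.le) α rfl).le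
  rw [← ofReal_measureReal]
  exact ENNReal.ofReal_le_ofReal (by linarith)

-- The kernel `α ↦ ⟨x|α⟩⟨α|y⟩` is bounded and continuous, so weak convergence of the mixing measures
-- passes to matrix elements.
open Filter Topology in
theorem isClassical_of_forall_isApproxClassical {n : ℕ} {ρ : Op n} (hρ : IsDensityOperator ρ)
    (h : ∀ ε : ℝ, 0 < ε → ∃ P : Measure (Fin n → ℂ),
      IsProbabilityMeasure P ∧ IsApproxClassical ρ ε P) : IsClassical ρ := by
  choose P hP hPρ using fun j : ℕ => h (1 / (j + 1)) Nat.one_div_pos_of_nat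
  have htight := isTightMeasureSet_range_of_isApproxClassical hρ
    tendsto_one_div_add_atTop_nhds_zero_nat hPρ
  let Q : ℕ → ProbabilityMeasure (Fin n → ℂ) := fun j => ⟨P j, hP j⟩
  have hcomp : IsCompact (closure (Set.range Q)) := by
    refine isCompact_closure_of_isTightMeasureSet (htight.subset ?_)
    rintro _ ⟨_, ⟨j, rfl⟩, rfl⟩
    exact ⟨j, rfl⟩
  -- An ultrafilter finer than `atTop` converges in the compact closure, replacing the extraction of
  -- a subsequence.
  let U : Ultrafilter ℕ := Ultrafilter.of atTop
  have hU : (U : Filter ℕ) ≤ atTop := Ultrafilter.of_le _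
  obtain ⟨L, -, hL⟩ := hcomp.ultrafilter_le_nhds (U.map Q) (by
    rw [le_principal_iff]
    exact mem_map.2 (univ_mem' fun j => subset_closure ⟨j, rfl⟩))
  have hQ : Tendsto Q U (𝓝 L) := hL
  rw [ProbabilityMeasure.tendsto_iff_forall_integral_rclike_tendsto ℂ] at hQ
  refine ⟨L, L.2, fun x y => ?_⟩
  have h1 := hQ (BoundedContinuousFunction.ofNormedAddCommGroup
    (fun α => kernel x y (coherent α)) ((continuous_kernel x y).comp continuous_coherent)
    (‖x‖ * ‖y‖) fun α => norm_kernel_le x y (norm_coherent α))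
  have h2 : Tendsto (fun j => ∫ α, kernel x y (coherent α) ∂(P j)) U (𝓝 ⟪x, ρ y⟫_ℂ) := by
    rw [tendsto_iff_norm_sub_tendsto_zero]
    refine squeeze_zero (fun _ => norm_nonneg _) (fun j => ?_)
      (g := fun j : ℕ => 1 / ((j : ℝ) + 1) * (‖x‖ * ‖y‖)) ?_
    · rw [norm_sub_rev]
      exact hPρ j x y
    · have := (tendsto_one_div_add_atTop_nhds_zero_nat (𝕜 := ℝ)).mul_const (‖x‖ * ‖y‖)
      rw [zero_mul] at this
      exact this.mono_left hU
  exact tendsto_nhds_unique h2 h1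

theorem convexRoof_eq_zero_iff_isClassical {n : ℕ} {f : Fock n → EReal}
    (hf : DominatesOverlap f) (hcoh : ∀ α : Fin n → ℂ, f (coherent α) ≤ 0) {ρ : Op n}
    (hρ : IsDensityOperator ρ) : convexRoof f ρ = 0 ↔ IsClassical ρ :=
  ⟨fun h => isClassical_of_forall_isApproxClassical hρ fun _ hε =>
    exists_isApproxClassical hf h hε, convexRoof_eq_zero_of_isClassical hcoh⟩

end BosonicModes
end

open BosonicModes in
theorem mainTheorem7 (n : ℕ) :
    (∀ ψ : PureState n, ∃ α : Fin n → ℂ,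
      ((traceDist (proj (ψ : Fock n)) (proj (coherent α)) ^ 2 : ℝ≥0∞) : EReal)
        ≤ (n : EReal) * varV 1 (ψ : Fock n)) ∧
    (∀ k : ℕ, 1 ≤ k → k ≤ 2 * n →
      (∀ ψ : PureState n, 0 ≤ varV k (ψ : Fock n)) ∧
      ∀ ρ : Op n, IsDensityOperator ρ → (convexRoof (varV k) ρ = 0 ↔ IsClassical ρ)) ∧
    (∀ k : ℕ, 1 ≤ k → k ≤ n →
      (∀ ψ : PureState n, 0 ≤ varW k (ψ : Fock n)) ∧
      ∀ ρ : Op n, IsDensityOperator ρ → (convexRoof (varW k) ρ = 0 ↔ IsClassical ρ)) := by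
  refine ⟨exists_coherent_traceDist_sq_le, fun k hk hkn => ⟨fun ψ => ?_, fun ρ hρ => ?_⟩,
    fun k hk hkn => ⟨fun ψ => ?_, fun ρ hρ => ?_⟩⟩
  · exact varV_nonneg (by simp) hk hkn
  · exact convexRoof_eq_zero_iff_isClassical (dominatesOverlap_varV hk hkn) (varV_coherent_le k) hρ
  · exact varW_nonneg (by simp) hk hkn
  · exact convexRoof_eq_zero_iff_isClassical (dominatesOverlap_varW hk hkn) (varW_coherent_le k) hρ
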